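/- **Conventions.** A *complex* is a finite set $V$ (of vertices) together with a family of subsets of $V$, called faces, that contains $\emptyset$ and is closed under passing to subsets. A *simplicial map* $K\to L$ is a map of the vertices taking faces to faces. The *body* $|K|\subset\mathbb R^V$ is the union of the simplices spanned by the faces, the vertices being the unit vectors; a simplicial map $f$ induces a map of bodies, affine on simplices, also denoted $f$. A *PL map* $|K|\to|L|$ is a map that is simplicial with respect to some subdivisions of $K$ and of $L$. PL maps $|P|\times[0,1]\to|Y|$ are defined similarly, with subdivisions of the cells $\sigma\times[0,1]$, $\sigma$ a face of $P$. Maps $f_0,f_1:|P|\to|Y|$ are *homotopic*, $f_0\simeq f_1$, if there is a PL map $|P|\times[0,1]\to|Y|$ that is $f_0$ on $|P|\times0$ and $f_1$ on $|P|\times1$. For a subcomplex $P\subset X$, a map $|P|\to|Y|$ *extends to* $X$ if it is the restriction to $|P|$ of a PL map $|X|\to|Y|$. **Proposition.** There is an algorithm that, given two complexes $P,Q$ (by lists of their faces) and a simplicial map $g:P\to Q$ (by the list of its values), constructs a triple $(\operatorname{Cyl}g;P,Q)$ of a complex $\operatorname{Cyl} g$ (called a mapping cylinder of $g$) and of two subcomplexes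 of it with disjoint vertex sets, isomorphic to $P$ and to $Q$ by given isomorphisms, and identified with them, such that every face of $\operatorname{Cyl}g$ with all vertices in $P$ is a face of $P$, and such that the following holds. (a) For any complex $Y$, a simplicial map $\beta:P\to Y$ extends to $\operatorname{Cyl} g$ if and only if there is a PL map $\varkappa:|Q|\to|Y|$ such that $\varkappa\circ g\simeq\beta$. (b) For any complex $X$ containing $P$ as a subcomplex, $g$ extends to $X$ if and only if the identity map of $Q$ extends to the complex $X\cup_P\operatorname{Cyl}g$ obtained from $X$ and $\operatorname{Cyl}g$ by gluing along $P$. -/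

import Mathlib

/-! ### Finite complexes and simplicial maps -/

/-- A (finite, abstract) complex with vertex set `V`: a family of subsets of `V`, called faces, that
contains `∅` and is closed under passing to subsets. (Not every vertex has to span a face.) -/
structure FinComplex (V : Type*) where
  faces : Finset (Finset V)
  empty_mem : ∅ ∈ faces
  down_closed : ∀ σ ∈ faces, ∀ τ ⊆ σ, τ ∈ faces

/-- A map between the vertex sets is simplicial if it maps faces to faces. -/
def IsSimplicialMap {V W : Type*} [DecidableEq W] (K : FinComplex V) (L : FinComplex W)
    (f : V → W) : Prop :=
  ∀ σ ∈ K.faces, σ.image f ∈ L.faces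

/-- `f` is an isomorphism of `K` onto a subcomplex of `L` (namely the complex of all `f(σ)`, for
the faces `σ` of `K`). -/
def IsSubcomplexEmbedding {V W : Type*} [DecidableEq W] (K : FinComplex V) (L : FinComplex W)
    (f : V → W) : Prop :=
  Function.Injective f ∧ IsSimplicialMap K L f

/-- The complex on the vertex set `W` whose faces are the images of the faces of `K`. -/
def FinComplex.image {V W : Type*} [DecidableEq W] (K : FinComplex V) (f : V → W) :
    FinComplex W where
  faces := K.faces.image (fun σ => σ.image f)
  empty_mem := Finset.mem_image.2 ⟨∅, K.empty_mem, rfl⟩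
  down_closed := by
    intro σ hσ τ hτ
    obtain ⟨ρ, hρ, rfl⟩ := Finset.mem_image.1 hσ
    obtain ⟨π, hπ, rfl⟩ := Finset.subset_image_iff.1 hτ
    exact Finset.mem_image.2 ⟨π, K.down_closed ρ hρ π hπ, rfl⟩

/-- The union of two complexes with the same vertex set. -/
def FinComplex.union {V : Type*} [DecidableEq V] (K L : FinComplex V) : FinComplex V where
  faces := K.faces ∪ L.faces
  empty_mem := Finset.mem_union_left _ K.empty_mem
  down_closed := by
    intro σ hσ τ hτ
    rcases Finset.mem_union.1 hσ with h | h
    · exact Finset.mem_union_left _ (K.down_closed σ h τ hτ)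
    · exact Finset.mem_union_right _ (L.down_closed σ h τ hτ)

/-! ### Gluing two complexes along a common subcomplex -/

/-- The vertex set of `X ∪_P C`, where the vertex set `V` of `P` is embedded into the vertex set
`U` of `X` and, by `j`, into the vertex set `T` of `C`: all the vertices of `X`, and those vertices
of `C` that do not come from `P`. -/
abbrev GlueVertex {V T : Type*} (U : Type*) (j : V → T) : Type _ :=
  U ⊕ {t : T // ∀ v, j v ≠ t}

/-- The inclusion of the vertices of `C` into those of `X ∪_P C`; the vertex `j v` of `C` is
identified with the vertex `i v` of `X`. -/
noncomputable def glueRight {V U T : Type*} [Fintype V] [DecidableEq T] (i : V → U) (j : V → T)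
    (t : T) : GlueVertex U j :=
  if h : ∃ v, j v = t then Sum.inl (i h.choose) else Sum.inr ⟨t, fun v hv => h ⟨v, hv⟩⟩

/-- The complex `X ∪_P C`, for the embeddings `i` of `P` into `X` and `j` of `P` into `C`. -/
noncomputable def glue {V U T : Type*} [Fintype V] [DecidableEq U] [DecidableEq T]
    (X : FinComplex U) (C : FinComplex T) (i : V → U) (j : V → T) :
    FinComplex (GlueVertex U j) :=
  (X.image Sum.inl).union (C.image (glueRight i j))

/-! ### Bodies -/

/-- The closed geometric simplex spanned by `σ` in `ℝ^V`, the vertices being the unit vectors. -/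
def simplexOf {V : Type*} [DecidableEq V] (σ : Finset V) : Set (V → ℝ) :=
  convexHull ℝ ((fun v => (Pi.single v 1 : V → ℝ)) '' (σ : Set V))

/-- The closed geometric simplices of a complex. -/
def FinComplex.cells {V : Type*} [DecidableEq V] (K : FinComplex V) : Set (Set (V → ℝ)) :=
  {c | ∃ σ ∈ K.faces, c = simplexOf σ}

/-- The body `|K|` (geometric realization): the union of the simplices of `K` in `ℝ^V`. -/
def FinComplex.body {V : Type*} [DecidableEq V] (K : FinComplex V) : Set (V → ℝ) :=
  ⋃₀ K.cells

/-- The map of bodies induced by a simplicial map: it sends `∑ x_v v` to `∑ x_v f(v)`, so it is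
`f` on the vertices and affine on each simplex. -/
def realize {V W : Type*} [Fintype V] [DecidableEq W] (f : V → W) (x : V → ℝ) : W → ℝ :=
  fun w => ∑ v with f v = w, x v

/-! ### Subdivisions, PL maps, and PL homotopies -/

/-- A finite geometric simplicial complex `S` subdivides a family of closed cells: `S` has the same
underlying space, and each simplex of `S` lies in one of the cells. -/
def IsSubdivision {E : Type*} [AddCommGroup E] [Module ℝ E]
    (S : Geometry.SimplicialComplex ℝ E) (cells : Set (Set E)) : Prop :=
  S.faces.Finite ∧ S.space = ⋃₀ cells ∧
    ∀ s ∈ S.faces, ∃ c ∈ cells, convexHull ℝ (s : Set E) ⊆ c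

/-- `f` is simplicial as a map from `S` to `T`: it sends the vertices of each simplex of `S` onto
the vertices of a simplex of `T`, and it is affine on each simplex of `S`. -/
def IsGeomSimplicial {E F : Type*} [AddCommGroup E] [Module ℝ E] [AddCommGroup F] [Module ℝ F]
    (S : Geometry.SimplicialComplex ℝ E) (T : Geometry.SimplicialComplex ℝ F) (f : E → F) : Prop :=
  ∀ s ∈ S.faces, (∃ t ∈ T.faces, f '' (s : Set E) = (t : Set F)) ∧
    ∃ A : E →ᵃ[ℝ] F, Set.EqOn f A (convexHull ℝ (s : Set E))

/-- `f` is piecewise linear from the union of the cells in `c` to the union of the cells in `d`: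
it is a simplicial map between certain subdivisions of them. Only the values of `f` on the union of
the cells in `c` matter. -/
def IsPLBetween {E F : Type*} [AddCommGroup E] [Module ℝ E] [AddCommGroup F] [Module ℝ F]
    (c : Set (Set E)) (d : Set (Set F)) (f : E → F) : Prop :=
  ∃ (S : Geometry.SimplicialComplex ℝ E) (T : Geometry.SimplicialComplex ℝ F),
    IsSubdivision S c ∧ IsSubdivision T d ∧ IsGeomSimplicial S T f

/-- `f` is a PL map `|K| → |L|`. -/
def IsPLMap {V W : Type*} [DecidableEq V] [DecidableEq W] (K : FinComplex V) (L : FinComplex W)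
    (f : (V → ℝ) → (W → ℝ)) : Prop :=
  IsPLBetween K.cells L.cells f

/-- The cells `σ × [0,1]` of `|K| × [0,1]`. -/
def FinComplex.prismCells {V : Type*} [DecidableEq V] (K : FinComplex V) :
    Set (Set ((V → ℝ) × ℝ)) :=
  {c | ∃ σ ∈ K.faces, c = simplexOf σ ×ˢ Set.Icc (0 : ℝ) 1}

/-- The maps `f₀` and `f₁` from `|K|` to `|L|` are homotopic: there is a PL map
`|K| × [0,1] → |L|` that is `f₀` on `|K| × 0` and `f₁` on `|K| × 1`. -/
def PLHomotopic {V W : Type*} [DecidableEq V] [DecidableEq W] (K : FinComplex V)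
    (L : FinComplex W) (f₀ f₁ : (V → ℝ) → (W → ℝ)) : Prop :=
  ∃ H : (V → ℝ) × ℝ → (W → ℝ), IsPLBetween K.prismCells L.cells H ∧
    ∀ x ∈ K.body, H (x, 0) = f₀ x ∧ H (x, 1) = f₁ x

/-- Let `P` be embedded into `X` by `i`. The map `f` from `|P|` to `|Y|` extends to a PL map
`|X| → |Y|`. -/
def ExtendsPL {V U W : Type*} [Fintype V] [DecidableEq V] [DecidableEq U] [DecidableEq W]
    (P : FinComplex V) (X : FinComplex U) (Y : FinComplex W) (i : V → U)
    (f : (V → ℝ) → (W → ℝ)) : Prop :=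
  ∃ F : (U → ℝ) → (W → ℝ), IsPLMap X Y F ∧ ∀ x ∈ P.body, F (realize i x) = f x

/-! ### Complexes and vertex maps as inputs and outputs of algorithms -/

/-- The finite data of a complex: the number of vertices, and a list of faces, each of them a list
of vertices (numbered from `0`). -/
abbrev ComplexCode : Type := ℕ × List (List ℕ)

/-- `c` describes `K`: the listed faces are exactly the faces of `K` (in any order, and with
repetitions allowed). -/
def IsComplexCode {n : ℕ} (c : ComplexCode) (K : FinComplex (Fin n)) : Prop :=
  c.1 = n ∧ (c.2.map List.toFinset).toFinset = K.faces.image (fun σ => σ.image Fin.val)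

/-- `l` is the list of values of the vertex map `f`. -/
def IsMapCode {m n : ℕ} (l : List ℕ) (f : Fin m → Fin n) : Prop :=
  l = List.ofFn (fun v => (f v : ℕ))

/-!
The mapping cylinder of `g : P → Q` is the complex `C` on the disjoint union of the vertex sets whose
faces are those of `Q` and all subsets of `ρ ∪ g(ρ)`, for the faces `ρ` of `P`
(`mappingCylinder`). Two properties of it carry the proof: `g` and the identity of `Q` define a
simplicial retraction `r : C → Q`, and the inclusion of `P` is contiguous, hence homotopic, to `g`
followed by the inclusion of `Q` (`exists_plOn_homotopy_of_contiguous`).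

For (a), an extension of `β` to `C` restricts to a map `κ` of `Q`, and the homotopy between the two
maps of `P` to `C` shows that `κ ∘ g ≃ β`. Conversely, if `κ ∘ g ≃ β`, then `κ ∘ r` is an extension
of `κ ∘ g` to `C`, and so `β` extends to `C` by the homotopy extension property
(`exists_extension_of_homotopy`). For (b), an extension of `g` to `X` and the retraction `r` agree
on `P` and define a retraction of `X ∪_P C` onto `Q`. Conversely, such a retraction restricts to a
map of `X` whose restriction to `P` is homotopic, through `C`, to `g`; again `g` extends to `X` by
homotopy extension.

All the maps have to be simplicial for suitable subdivisions of the source and of the target. This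
notion is hard to work with directly (composites, for example, need common subdivisions), so it is
replaced by an equivalent one: `PLOn f D` says that `f` is continuous on `D` and agrees with one of
finitely many affine maps on each cell of a finite hyperplane arrangement. This is closed under
composition, maxima and minima, and gluing along closed semilinear pieces, so that the homotopy
extension can be written down by explicit formulas. The equivalence is `IsPLBetween.plOn` and
`PLOn.isPLBetween`. For the second, Fourier–Motzkin elimination shows that the images of cells are
unions of cells of some arrangement in the target; after refinement `f` maps open cells onto open
cells, and derived subdivisions with compatible choices of points in the cells make `f` simplicial.
-/

/-! ### Semilinear sets -/

section Semilinear

variable {E F : Type*} [AddCommGroup E] [Module ℝ E] [AddCommGroup F] [Module ℝ F]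

/-- The points `x` and `y` are on the same side of each hyperplane `a = 0`, `a ∈ 𝒜` (lying on the
hyperplane being a side of its own). -/
def SameSigns (𝒜 : Set (E →ᵃ[ℝ] ℝ)) (x y : E) : Prop :=
  ∀ a ∈ 𝒜, SignType.sign (a x) = SignType.sign (a y)

/-- `s` is a union of open cells of the hyperplane arrangement `𝒜`. -/
def IsUnionOfCells (𝒜 : Set (E →ᵃ[ℝ] ℝ)) (s : Set E) : Prop :=
  ∀ x ∈ s, ∀ y, SameSigns 𝒜 x y → y ∈ s

/-- `s` is a union of open cells of some finite hyperplane arrangement. -/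
def IsSemilinear (s : Set E) : Prop :=
  ∃ 𝒜 : Set (E →ᵃ[ℝ] ℝ), 𝒜.Finite ∧ IsUnionOfCells 𝒜 s

theorem SameSigns.refl (𝒜 : Set (E →ᵃ[ℝ] ℝ)) (x : E) : SameSigns 𝒜 x x := fun _ _ => rfl

theorem SameSigns.trans {𝒜 : Set (E →ᵃ[ℝ] ℝ)} {x y z : E} (h : SameSigns 𝒜 x y)
    (h' : SameSigns 𝒜 y z) : SameSigns 𝒜 x z := fun a ha => (h a ha).trans (h' a ha)

theorem SameSigns.mono {𝒜 ℬ : Set (E →ᵃ[ℝ] ℝ)} {x y : E} (h : SameSigns ℬ x y) (hs : 𝒜 ⊆ ℬ) :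
    SameSigns 𝒜 x y := fun a ha => h a (hs ha)

theorem IsUnionOfCells.mono {𝒜 ℬ : Set (E →ᵃ[ℝ] ℝ)} {s : Set E} (h : IsUnionOfCells 𝒜 s)
    (hs : 𝒜 ⊆ ℬ) : IsUnionOfCells ℬ s := fun x hx y hy => h x hx y (hy.mono hs)

theorem isUnionOfCells_sameSigns (𝒜 : Set (E →ᵃ[ℝ] ℝ)) (x : E) :
    IsUnionOfCells 𝒜 {y | SameSigns 𝒜 x y} := fun _ hy _ hz => hy.trans hz

theorem IsSemilinear.inter {s t : Set E} (hs : IsSemilinear s) (ht : IsSemilinear t) :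
    IsSemilinear (s ∩ t) := by
  obtain ⟨𝒜, h𝒜, hs⟩ := hs
  obtain ⟨ℬ, hℬ, ht⟩ := ht
  exact ⟨𝒜 ∪ ℬ, h𝒜.union hℬ, fun x hx y hy =>
    ⟨hs x hx.1 y (hy.mono Set.subset_union_left), ht x hx.2 y (hy.mono Set.subset_union_right)⟩⟩

theorem IsSemilinear.iUnion {ι : Type*} [Finite ι] {s : ι → Set E}
    (hs : ∀ i, IsSemilinear (s i)) : IsSemilinear (⋃ i, s i) := by
  choose 𝒜 h𝒜 hs using hs
  refine ⟨⋃ i, 𝒜 i, Set.finite_iUnion h𝒜, fun x hx y hy => ?_⟩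
  obtain ⟨i, hi⟩ := Set.mem_iUnion.1 hx
  exact Set.mem_iUnion.2 ⟨i, hs i x hi y (hy.mono (Set.subset_iUnion _ i))⟩

theorem IsSemilinear.sUnion {c : Set (Set E)} (hc : c.Finite) (hs : ∀ s ∈ c, IsSemilinear s) :
    IsSemilinear (⋃₀ c) := by
  have := hc.to_subtype
  rw [Set.sUnion_eq_iUnion]
  exact IsSemilinear.iUnion fun i => hs i i.2

theorem IsSemilinear.preimage {s : Set F} (hs : IsSemilinear s) (A : E →ᵃ[ℝ] F) :
    IsSemilinear (A ⁻¹' s) := by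
  obtain ⟨𝒜, h𝒜, hs⟩ := hs
  refine ⟨(fun a => a.comp A) '' 𝒜, h𝒜.image _, fun x hx y hy => hs _ hx _ fun a ha => ?_⟩
  exact hy _ ⟨a, ha, rfl⟩

theorem isSemilinear_setOf_forall_nonneg {𝒜 : Set (E →ᵃ[ℝ] ℝ)} (h : 𝒜.Finite) :
    IsSemilinear {x | ∀ a ∈ 𝒜, 0 ≤ a x} := by
  refine ⟨𝒜, h, fun x hx y hy a ha => ?_⟩
  rw [← sign_nonneg_iff, ← hy a ha, sign_nonneg_iff]
  exact hx a ha

theorem isSemilinear_le (a b : E →ᵃ[ℝ] ℝ) : IsSemilinear {x | a x ≤ b x} := by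
  convert isSemilinear_setOf_forall_nonneg (Set.finite_singleton (b - a)) using 1
  ext x
  simp

theorem isSemilinear_eq [FiniteDimensional ℝ F] (A B : E →ᵃ[ℝ] F) :
    IsSemilinear {x | A x = B x} := by
  let b := Module.finBasis ℝ F
  refine ⟨Set.range fun i => (b.coord i).toAffineMap.comp (A - B), Set.finite_range _,
    fun x hx y hy => ?_⟩
  rw [Set.mem_ofPred_eq, ← sub_eq_zero] at hx ⊢
  refine b.ext_elem fun i => ?_
  have := hy _ ⟨i, rfl⟩
  have h0 : b.repr (A x) = b.repr (B x) := by rw [sub_eq_zero.1 hx]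
  simp [h0] at this
  have := sign_eq_zero_iff.1 this.symm
  simpa using this

/-- The Fourier–Motzkin elimination of one variable: the shadow of a semilinear set in the
direction `v` is semilinear. The arrangement for the shadow compares the parameters at which the
lines of direction `v` cross the hyperplanes of the given arrangement. -/
theorem IsSemilinear.exists_add_smul {s : Set E} (hs : IsSemilinear s) (v : E) :
    IsSemilinear {x | ∃ t : ℝ, x + t • v ∈ s} := by
  classical
  obtain ⟨𝒜, h𝒜, hs⟩ := hs
  let root : (E →ᵃ[ℝ] ℝ) → (E →ᵃ[ℝ] ℝ) := fun a => -(a.linear v)⁻¹ • a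
  have key : ∀ (a : E →ᵃ[ℝ] ℝ) (x : E) (t : ℝ), a.linear v ≠ 0 →
      a (x + t • v) = a.linear v * (t - root a x) := by
    intro a x t h
    have : a (x + t • v) = a x + t * a.linear v := by
      have := a.map_vadd x (t • v)
      simp only [vadd_eq_add, map_smul, smul_eq_mul] at this
      rw [add_comm x, this, add_comm]
    rw [this]
    simp only [root, AffineMap.coe_smul, Pi.smul_apply, smul_eq_mul]
    field_simp
    ring
  refine ⟨𝒜 ∪ Set.image2 (fun a b => root a - root b) 𝒜 𝒜, h𝒜.union (h𝒜.image2 _ h𝒜), ?_⟩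
  rintro x ⟨t, ht⟩ y hxy
  have hroot : ∀ a ∈ 𝒜, ∀ b ∈ 𝒜, SignType.sign (root a x - root b x) =
      SignType.sign (root a y - root b y) := fun a ha b hb =>
    hxy _ (Or.inr ⟨a, ha, b, hb, rfl⟩)
  suffices ∃ u : ℝ, ∀ a ∈ 𝒜, a.linear v ≠ 0 →
      SignType.sign (t - root a x) = SignType.sign (u - root a y) by
    obtain ⟨u, hu⟩ := this
    refine ⟨u, hs _ ht _ fun a ha => ?_⟩
    by_cases h : a.linear v = 0
    · have : ∀ (z : E) (r : ℝ), a (z + r • v) = a z := by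
        intro z r
        have := a.map_vadd z (r • v)
        simpa [add_comm, h] using this
      rw [this, this]
      exact hxy a (Or.inl ha)
    · rw [key a x t h, key a y u h, sign_mul, sign_mul, hu a ha h]
  by_cases h : ∃ a ∈ 𝒜, a.linear v ≠ 0 ∧ root a x = t
  · obtain ⟨a, ha, -, rfl⟩ := h
    exact ⟨root a y, fun b hb _ => hroot a ha b hb⟩
  push Not at h
  let R := h𝒜.toFinset.filter fun a => a.linear v ≠ 0
  have hR : ∀ a, a ∈ R ↔ a ∈ 𝒜 ∧ a.linear v ≠ 0 := by simp [R]
  obtain ⟨u, hlo, hhi⟩ := Order.exists_between_finsets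
    ((R.filter fun a => root a x < t).image fun a => root a y)
    ((R.filter fun a => t < root a x).image fun a => root a y) (by
      simp only [Finset.mem_image, Finset.mem_filter, hR]
      rintro _ ⟨a, ⟨⟨ha, -⟩, hat⟩, rfl⟩ _ ⟨b, ⟨⟨hb, -⟩, hbt⟩, rfl⟩
      have := hroot a ha b hb
      rw [sign_neg (by linarith)] at this
      have := sign_eq_neg_one_iff.1 this.symm
      linarith)
  refine ⟨u, fun a ha hav => ?_⟩
  rcases lt_or_gt_of_ne (h a ha hav) with hlt | hgt
  · have := hlo (root a y) (Finset.mem_image_of_mem _ (by simp [hR, ha, hav, hlt]))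
    rw [sign_pos (by linarith), sign_pos (by linarith)]
  · have := hhi (root a y) (Finset.mem_image_of_mem _ (by simp [hR, ha, hav, hgt]))
    rw [sign_neg (by linarith), sign_neg (by linarith)]

theorem IsSemilinear.exists_add_mem {W : Submodule ℝ E} (hW : W.FG) {s : Set E}
    (hs : IsSemilinear s) : IsSemilinear {x | ∃ w ∈ W, x + w ∈ s} := by
  induction W, hW using Submodule.fg_induction generalizing s with
  | singleton v =>
    convert hs.exists_add_smul v using 1
    ext x
    simp [Submodule.mem_span_singleton]
  | sup W₁ W₂ _ _ h₁ h₂ =>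
    convert h₁ (h₂ hs) using 1
    ext x
    simp only [Submodule.mem_sup, Set.mem_ofPred_eq]
    constructor
    · rintro ⟨_, ⟨u, hu, v, hv, rfl⟩, h⟩
      exact ⟨u, hu, v, hv, by rwa [add_assoc]⟩
    · rintro ⟨u, hu, v, hv, h⟩
      exact ⟨_, ⟨u, hu, v, hv, rfl⟩, by rwa [← add_assoc]⟩

theorem IsSemilinear.image [FiniteDimensional ℝ E] [FiniteDimensional ℝ F] {s : Set E}
    (hs : IsSemilinear s) (A : E →ᵃ[ℝ] F) : IsSemilinear (A '' s) := by
  let fst : E × F →ᵃ[ℝ] E := (LinearMap.fst ℝ E F).toAffineMap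
  let snd : E × F →ᵃ[ℝ] F := (LinearMap.snd ℝ E F).toAffineMap
  have hG : IsSemilinear (fst ⁻¹' s ∩ {p | snd p = A.comp fst p}) :=
    (hs.preimage fst).inter (isSemilinear_eq _ _)
  have hW : (LinearMap.range (LinearMap.inl ℝ E F)).FG := Submodule.FG.of_finite
  convert (hG.exists_add_mem hW).preimage (LinearMap.inr ℝ E F).toAffineMap using 1
  ext y
  simp [fst, snd, eq_comm]

/-- Finitely many semilinear sets are unions of cells of a single arrangement. -/
theorem exists_common_arrangement {c : Set (Set E)} (hc : c.Finite)
    (h : ∀ s ∈ c, IsSemilinear s) :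
    ∃ 𝒜 : Set (E →ᵃ[ℝ] ℝ), 𝒜.Finite ∧ ∀ s ∈ c, IsUnionOfCells 𝒜 s := by
  choose! 𝒜 h𝒜 hs using h
  exact ⟨⋃ s ∈ c, 𝒜 s, hc.biUnion h𝒜, fun s hsc =>
    (hs s hsc).mono (Set.subset_biUnion_of_mem (u := 𝒜) hsc)⟩

/-- A finite arrangement has finitely many cells. -/
theorem finite_range_cells {𝒜 : Set (E →ᵃ[ℝ] ℝ)} (h𝒜 : 𝒜.Finite) (D : Set E) :
    (Set.range fun x => {y ∈ D | SameSigns 𝒜 x y}).Finite := by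
  have := h𝒜.to_subtype
  refine (Set.finite_range fun σ : 𝒜 → SignType =>
    {y ∈ D | ∀ a : 𝒜, σ a = SignType.sign (a.1 y)}).subset ?_
  rintro _ ⟨x, rfl⟩
  exact ⟨fun a => SignType.sign (a.1 x), by simp [SameSigns]⟩

end Semilinear

/-! ### Calculus of piecewise linear functions -/

section PiecewiseLinear

variable {E F G : Type*} [NormedAddCommGroup E] [NormedSpace ℝ E]
  [NormedAddCommGroup F] [NormedSpace ℝ F] [NormedAddCommGroup G] [NormedSpace ℝ G]

/-- `f` is piecewise linear on `D`: it is continuous there, and there are a finite hyperplane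
arrangement `𝒜` and a finite set `ℳ` of affine maps such that `f` agrees with some member of `ℳ`
on the trace in `D` of each cell of `𝒜`. No triangulation of `D` is asked for, so that this notion
is visibly closed under composition. -/
def PLOn (f : E → F) (D : Set E) : Prop :=
  ContinuousOn f D ∧ ∃ (𝒜 : Set (E →ᵃ[ℝ] ℝ)) (ℳ : Set (E →ᵃ[ℝ] F)), 𝒜.Finite ∧ ℳ.Finite ∧
    ∀ x ∈ D, ∃ A ∈ ℳ, ∀ y ∈ D, SameSigns 𝒜 x y → f y = A y

theorem PLOn.continuousOn {f : E → F} {D : Set E} (h : PLOn f D) : ContinuousOn f D := h.1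

theorem PLOn.mono {f : E → F} {D D' : Set E} (h : PLOn f D) (hD : D' ⊆ D) : PLOn f D' := by
  obtain ⟨hc, 𝒜, ℳ, h𝒜, hℳ, h⟩ := h
  refine ⟨hc.mono hD, 𝒜, ℳ, h𝒜, hℳ, fun x hx => ?_⟩
  obtain ⟨A, hA, h⟩ := h x (hD hx)
  exact ⟨A, hA, fun y hy => h y (hD hy)⟩

theorem PLOn.congr {f g : E → F} {D : Set E} (h : PLOn f D) (hfg : Set.EqOn g f D) :
    PLOn g D := by
  obtain ⟨hc, 𝒜, ℳ, h𝒜, hℳ, h⟩ := h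
  refine ⟨hc.congr hfg, 𝒜, ℳ, h𝒜, hℳ, fun x hx => ?_⟩
  obtain ⟨A, hA, h⟩ := h x hx
  exact ⟨A, hA, fun y hy hxy => (hfg hy).trans (h y hy hxy)⟩

theorem PLOn.comp {f : E → F} {g : F → G} {D : Set E} {D' : Set F} (hg : PLOn g D')
    (hf : PLOn f D) (hfD : Set.MapsTo f D D') : PLOn (fun x => g (f x)) D := by
  obtain ⟨hgc, ℬ, 𝒩, hℬ, h𝒩, hg⟩ := hg
  obtain ⟨hfc, 𝒜, ℳ, h𝒜, hℳ, hf⟩ := hf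
  refine ⟨hgc.comp hfc hfD, 𝒜 ∪ Set.image2 (fun b A => AffineMap.comp b A) ℬ ℳ,
    Set.image2 (fun B A => AffineMap.comp B A) 𝒩 ℳ, h𝒜.union (hℬ.image2 _ hℳ),
    h𝒩.image2 _ hℳ, fun x hx => ?_⟩
  obtain ⟨A, hA, hfA⟩ := hf x hx
  obtain ⟨B, hB, hgB⟩ := hg (f x) (hfD hx)
  refine ⟨B.comp A, ⟨B, hB, A, hA, rfl⟩, fun y hy hxy => ?_⟩
  have hfy := hfA y hy (hxy.mono Set.subset_union_left)
  have hfx := hfA x hx (SameSigns.refl _ _)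
  have hgy : g (f y) = B (f y) := hgB (f y) (hfD hy) fun b hb => by
    rw [hfx, hfy]
    exact hxy _ (Or.inr ⟨b, hb, A, hA, rfl⟩)
  change g (f y) = B (A y)
  rw [hgy, hfy]

theorem PLOn.prodMk {f : E → F} {g : E → G} {D : Set E} (hf : PLOn f D) (hg : PLOn g D) :
    PLOn (fun x => (f x, g x)) D := by
  obtain ⟨hgc, ℬ, 𝒩, hℬ, h𝒩, hg⟩ := hg
  obtain ⟨hfc, 𝒜, ℳ, h𝒜, hℳ, hf⟩ := hf
  refine ⟨hfc.prodMk hgc, 𝒜 ∪ ℬ, Set.image2 AffineMap.prod ℳ 𝒩, h𝒜.union hℬ,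
    hℳ.image2 _ h𝒩, fun x hx => ?_⟩
  obtain ⟨A, hA, hfA⟩ := hf x hx
  obtain ⟨B, hB, hgB⟩ := hg x hx
  refine ⟨A.prod B, ⟨A, hA, B, hB, rfl⟩, fun y hy hxy => ?_⟩
  simp [hfA y hy (hxy.mono Set.subset_union_left), hgB y hy (hxy.mono Set.subset_union_right)]

theorem AffineMap.plOn [FiniteDimensional ℝ E] (A : E →ᵃ[ℝ] F) (D : Set E) : PLOn A D :=
  ⟨A.continuous_of_finiteDimensional.continuousOn, ∅, {A}, Set.finite_empty,
    Set.finite_singleton A, fun _ _ => ⟨A, rfl, fun _ _ _ => rfl⟩⟩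

theorem LinearMap.plOn [FiniteDimensional ℝ E] (A : E →ₗ[ℝ] F) (D : Set E) : PLOn A D :=
  A.toAffineMap.plOn D

theorem plOn_const (c : F) (D : Set E) : PLOn (fun _ => c) D :=
  ⟨continuousOn_const, ∅, {AffineMap.const ℝ E c}, Set.finite_empty,
    Set.finite_singleton _, fun _ _ => ⟨_, rfl, fun _ _ _ => rfl⟩⟩

theorem plOn_apply {V : Type*} [Fintype V] (v : V) (D : Set (V → ℝ)) : PLOn (fun x => x v) D :=
  (LinearMap.proj (R := ℝ) (φ := fun _ : V => ℝ) v).plOn D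

theorem LinearMap.comp_plOn [FiniteDimensional ℝ F] (A : F →ₗ[ℝ] G) {f : E → F} {D : Set E}
    (hf : PLOn f D) : PLOn (fun x => A (f x)) D :=
  (A.plOn Set.univ).comp hf (Set.mapsTo_univ _ _)

theorem PLOn.add [FiniteDimensional ℝ F] {f g : E → F} {D : Set E} (hf : PLOn f D)
    (hg : PLOn g D) : PLOn (fun x => f x + g x) D :=
  (LinearMap.fst ℝ F F + LinearMap.snd ℝ F F).comp_plOn (hf.prodMk hg)

theorem PLOn.sub [FiniteDimensional ℝ F] {f g : E → F} {D : Set E} (hf : PLOn f D)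
    (hg : PLOn g D) : PLOn (fun x => f x - g x) D :=
  (LinearMap.fst ℝ F F - LinearMap.snd ℝ F F).comp_plOn (hf.prodMk hg)

theorem PLOn.const_mul {f : E → ℝ} {D : Set E} (c : ℝ) (hf : PLOn f D) :
    PLOn (fun x => c * f x) D :=
  (LinearMap.lsmul ℝ ℝ c).comp_plOn hf

theorem PLOn.sum [FiniteDimensional ℝ F] {ι : Type*} {f : ι → E → F} {D : Set E} (s : Finset ι)
    (hf : ∀ i ∈ s, PLOn (f i) D) : PLOn (fun x => ∑ i ∈ s, f i x) D := by
  classical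
  induction s using Finset.induction_on with
  | empty => simpa using plOn_const 0 D
  | insert i s hi ih =>
    simp only [Finset.sum_insert hi]
    exact (hf i (Finset.mem_insert_self _ _)).add
      (ih fun j hj => hf j (Finset.mem_insert_of_mem hj))

theorem PLOn.pi {V : Type*} [Fintype V] {f : E → V → ℝ} {D : Set E}
    (hf : ∀ v, PLOn (fun x => f x v) D) : PLOn f D := by
  classical
  refine (PLOn.sum Finset.univ fun v _ =>
    (LinearMap.single ℝ (fun _ : V => ℝ) v).comp_plOn (hf v)).congr fun x _ => ?_
  ext w
  simp

theorem PLOn.max {f g : E → ℝ} {D : Set E} (hf : PLOn f D) (hg : PLOn g D) :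
    PLOn (fun x => Max.max (f x) (g x)) D := by
  refine PLOn.comp (g := fun p : ℝ × ℝ => Max.max p.1 p.2) (D' := Set.univ) ?_ (hf.prodMk hg)
    (Set.mapsTo_univ _ _)
  refine ⟨by fun_prop, {(LinearMap.fst ℝ ℝ ℝ - LinearMap.snd ℝ ℝ ℝ).toAffineMap},
    {(LinearMap.fst ℝ ℝ ℝ).toAffineMap, (LinearMap.snd ℝ ℝ ℝ).toAffineMap},
    Set.finite_singleton _, by simp, fun p _ => ?_⟩
  rcases le_total p.2 p.1 with h | h
  · refine ⟨_, Or.inl rfl, fun q _ hq => ?_⟩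
    have := hq _ rfl
    simp only [LinearMap.coe_toAffineMap, LinearMap.sub_apply, LinearMap.fst_apply,
      LinearMap.snd_apply] at this ⊢
    refine max_eq_left ?_
    rw [← sub_nonneg, ← sign_nonneg_iff] at h ⊢
    rwa [← this]
  · refine ⟨_, Or.inr rfl, fun q _ hq => ?_⟩
    have := hq _ rfl
    simp only [LinearMap.coe_toAffineMap, LinearMap.sub_apply, LinearMap.fst_apply,
      LinearMap.snd_apply] at this ⊢
    refine max_eq_right ?_
    rw [← sub_nonpos, ← sign_nonpos_iff] at h ⊢
    rwa [← this]

theorem PLOn.min {f g : E → ℝ} {D : Set E} (hf : PLOn f D) (hg : PLOn g D) :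
    PLOn (fun x => Min.min (f x) (g x)) D := by
  refine ((hf.add hg).sub (hf.max hg)).congr fun x _ => ?_
  have := min_add_max (f x) (g x)
  simp only
  linarith

theorem PLOn.isSemilinear_preimage {f : E → F} {D : Set E} {s : Set F} (hf : PLOn f D)
    (hD : IsSemilinear D) (hs : IsSemilinear s) : IsSemilinear (D ∩ f ⁻¹' s) := by
  obtain ⟨-, 𝒜, ℳ, h𝒜, hℳ, hf⟩ := hf
  obtain ⟨ℬ, hℬ, hs⟩ := hs
  obtain ⟨𝒟, h𝒟, hD⟩ := hD
  refine ⟨𝒟 ∪ (𝒜 ∪ Set.image2 (fun b A => AffineMap.comp b A) ℬ ℳ),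
    h𝒟.union (h𝒜.union (hℬ.image2 _ hℳ)), fun x hx y hxy => ?_⟩
  have hy : y ∈ D := hD x hx.1 y (hxy.mono Set.subset_union_left)
  obtain ⟨A, hA, hfA⟩ := hf x hx.1
  refine ⟨hy, hs (f x) hx.2 _ fun b hb => ?_⟩
  rw [hfA x hx.1 (SameSigns.refl _ _), hfA y hy fun a ha => hxy a (Or.inr (Or.inl ha))]
  exact hxy _ (Or.inr (Or.inr ⟨b, hb, A, hA, rfl⟩))

theorem PLOn.isSemilinear_le {f g : E → ℝ} {D : Set E} (hf : PLOn f D) (hg : PLOn g D)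
    (hD : IsSemilinear D) : IsSemilinear {x ∈ D | f x ≤ g x} :=
  (hf.prodMk hg).isSemilinear_preimage hD
    (_root_.isSemilinear_le (LinearMap.fst ℝ ℝ ℝ).toAffineMap (LinearMap.snd ℝ ℝ ℝ).toAffineMap)

theorem PLOn.union {f : E → F} {D D' : Set E} (hf : PLOn f D) (hf' : PLOn f D')
    (hD : IsClosed D) (hD' : IsClosed D') (hs : IsSemilinear D) (hs' : IsSemilinear D') :
    PLOn f (D ∪ D') := by
  obtain ⟨hc, 𝒜, ℳ, h𝒜, hℳ, hf⟩ := hf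
  obtain ⟨hc', ℬ, 𝒩, hℬ, h𝒩, hf'⟩ := hf'
  obtain ⟨𝒞, h𝒞, hs⟩ := hs
  obtain ⟨𝒟, h𝒟, hs'⟩ := hs'
  refine ⟨hc.union_of_isClosed hc' hD hD', (𝒜 ∪ ℬ) ∪ (𝒞 ∪ 𝒟), ℳ ∪ 𝒩,
    (h𝒜.union hℬ).union (h𝒞.union h𝒟), hℳ.union h𝒩, ?_⟩
  rintro x (hx | hx)
  · obtain ⟨A, hA, h⟩ := hf x hx
    refine ⟨A, Or.inl hA, fun y _ hy => h y (hs x hx y (hy.mono ?_)) (hy.mono ?_)⟩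
    · exact fun a ha => Or.inr (Or.inl ha)
    · exact fun a ha => Or.inl (Or.inl ha)
  · obtain ⟨A, hA, h⟩ := hf' x hx
    refine ⟨A, Or.inr hA, fun y _ hy => h y (hs' x hx y (hy.mono ?_)) (hy.mono ?_)⟩
    · exact fun a ha => Or.inr (Or.inr ha)
    · exact fun a ha => Or.inl (Or.inr ha)

theorem plOn_sUnion {f : E → F} {c : Set (Set E)} (hc : c.Finite) (hf : ∀ s ∈ c, PLOn f s)
    (hcl : ∀ s ∈ c, IsClosed s) (hsl : ∀ s ∈ c, IsSemilinear s) : PLOn f (⋃₀ c) := by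
  induction c, hc using Set.Finite.induction_on with
  | empty =>
    refine ⟨by simp, ∅, ∅, Set.finite_empty, Set.finite_empty, by simp⟩
  | @insert s c _ hc ih =>
    rw [Set.sUnion_insert]
    have hcl' : ∀ t ∈ c, IsClosed t := fun t ht => hcl t (Or.inr ht)
    have hsl' : ∀ t ∈ c, IsSemilinear t := fun t ht => hsl t (Or.inr ht)
    exact (hf s (Or.inl rfl)).union (ih (fun t ht => hf t (Or.inr ht)) hcl' hsl')
      (hcl s (Or.inl rfl)) (Set.sUnion_eq_biUnion ▸ hc.isClosed_biUnion hcl') (hsl s (Or.inl rfl))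
      (IsSemilinear.sUnion hc hsl')

end PiecewiseLinear

/-! ### Derived subdivisions -/

section DerivedSubdivision

variable {E ι : Type*}

/-- The face relation between the sign vectors of cells: some signs may degenerate to `0`. -/
def IsFaceSign (σ τ : ι → SignType) : Prop := ∀ i, σ i = 0 ∨ σ i = τ i

/-- The signs of the functions `φ i` at a point. -/
noncomputable def signVec (φ : ι → E → ℝ) (x : E) : ι → SignType := fun i => SignType.sign (φ i x)

/-- The closure of the cell of `x`, for the partition of `D` by the signs of the `φ i`. -/
def closedCell (D : Set E) (φ : ι → E → ℝ) (x : E) : Set E :=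
  {y ∈ D | IsFaceSign (signVec φ y) (signVec φ x)}

theorem IsFaceSign.refl (σ : ι → SignType) : IsFaceSign σ σ := fun _ => Or.inr rfl

theorem IsFaceSign.trans {ρ σ τ : ι → SignType} (h : IsFaceSign ρ σ) (h' : IsFaceSign σ τ) :
    IsFaceSign ρ τ := fun i => by
  rcases h i with h | h
  · exact Or.inl h
  · rcases h' i with h' | h'
    · exact Or.inl (h.trans h')
    · exact Or.inr (h.trans h')

theorem IsFaceSign.ncard_lt [Finite ι] {σ τ : ι → SignType} (h : IsFaceSign σ τ) (hne : σ ≠ τ) :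
    {i | σ i ≠ 0}.ncard < {i | τ i ≠ 0}.ncard := by
  refine Set.ncard_lt_ncard ⟨fun i hi => ?_, fun hsub => hne (funext fun i => ?_)⟩
  · rcases h i with h | h
    · exact absurd h hi
    · exact fun h0 => hi (h.trans h0)
  · rcases h i with h | h
    · by_contra hi
      exact hsub (a := i) (fun h0 => hi (h.trans h0.symm)) h
    · exact h

theorem self_mem_closedCell {D : Set E} {φ : ι → E → ℝ} {x : E} (hx : x ∈ D) : x ∈ closedCell D φ x :=
  ⟨hx, IsFaceSign.refl _⟩

/-- A flag: a finite set of chosen points `b σ` of cells, where the cells `σ` involved are pairwise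
incident. -/
structure IsFlag (D : Set E) (φ : ι → E → ℝ) (b : (ι → SignType) → E) (s : Finset E) : Prop where
  mem : ∀ x ∈ s, x ∈ D
  chosen : ∀ x ∈ s, b (signVec φ x) = x
  chain : ∀ x ∈ s, ∀ y ∈ s, IsFaceSign (signVec φ x) (signVec φ y) ∨
    IsFaceSign (signVec φ y) (signVec φ x)

namespace IsFlag

variable {D : Set E} {φ : ι → E → ℝ} {b : (ι → SignType) → E} {s t : Finset E}

theorem mono (hs : IsFlag D φ b s) (h : t ⊆ s) : IsFlag D φ b t :=
  ⟨fun x hx => hs.mem x (h hx), fun x hx => hs.chosen x (h hx),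
    fun x hx y hy => hs.chain x (h hx) y (h hy)⟩

/-- Every nonempty flag has a top point, in whose closed cell it lies. -/
theorem exists_top [Finite ι] (hs : IsFlag D φ b s) (hne : s.Nonempty) :
    ∃ x ∈ s, (s : Set E) ⊆ closedCell D φ x := by
  obtain ⟨x, hx, hmax⟩ := s.exists_max_image (fun x => {i | signVec φ x i ≠ 0}.ncard) hne
  refine ⟨x, hx, fun y hy => ⟨hs.mem y hy, ?_⟩⟩
  rcases hs.chain y hy x hx with h | h
  · exact h
  · by_cases heq : signVec φ x = signVec φ y
    · rw [heq]
      exact IsFaceSign.refl _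
    · exact absurd (h.ncard_lt heq) (not_lt.2 (hmax y hy))

end IsFlag

theorem setOf_face_sign_eq (s : SignType) :
    {r : ℝ | SignType.sign r = 0 ∨ SignType.sign r = s} = {0} ∨
      {r : ℝ | SignType.sign r = 0 ∨ SignType.sign r = s} = Set.Iic 0 ∨
      {r : ℝ | SignType.sign r = 0 ∨ SignType.sign r = s} = Set.Ici 0 := by
  cases s
  · refine Or.inl (Set.ext fun r => ?_)
    simp
  · refine Or.inr (Or.inl (Set.ext fun r => ?_))
    rcases lt_trichotomy r 0 with h | rfl | h
    · simp [h, h.le, h.ne]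
    · simp
    · simp [h, h.ne', not_le.2]
  · refine Or.inr (Or.inr (Set.ext fun r => ?_))
    rcases lt_trichotomy r 0 with h | rfl | h
    · simp [h, h.ne, not_le.2]
    · simp
    · simp [h, h.le, h.ne']

theorem convex_setOf_face_sign (s : SignType) :
    Convex ℝ {r : ℝ | SignType.sign r = 0 ∨ SignType.sign r = s} := by
  rcases setOf_face_sign_eq s with h | h | h <;> rw [h]
  exacts [convex_singleton _, convex_Iic _, convex_Ici _]

theorem isClosed_setOf_face_sign (s : SignType) :
    IsClosed {r : ℝ | SignType.sign r = 0 ∨ SignType.sign r = s} := by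
  rcases setOf_face_sign_eq s with h | h | h <;> rw [h]
  exacts [isClosed_singleton, isClosed_Iic, isClosed_Ici]

theorem sign_convex_combination {a b w w' : ℝ} (hw : 0 < w) (hw' : 0 ≤ w')
    (h : SignType.sign b = 0 ∨ SignType.sign b = SignType.sign a) :
    SignType.sign (w * a + w' * b) = SignType.sign a := by
  rcases lt_trichotomy a 0 with ha | rfl | ha
  · have hb : b ≤ 0 := by
      rcases h with h | h
      · exact (sign_eq_zero_iff.1 h).le
      · exact (sign_eq_neg_one_iff.1 (h.trans (sign_neg ha))).le
    rw [sign_neg ha, sign_neg]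
    nlinarith [mul_nonneg hw' (neg_nonneg.2 hb), mul_pos hw (neg_pos.2 ha)]
  · have hb : b = 0 := by simpa using h
    simp [hb]
  · have hb : 0 ≤ b := by
      rcases h with h | h
      · exact (sign_eq_zero_iff.1 h).ge
      · exact (sign_eq_one_iff.1 (h.trans (sign_pos ha))).le
    rw [sign_pos ha, sign_pos]
    nlinarith [mul_nonneg hw' hb, mul_pos hw ha]

variable [NormedAddCommGroup E] [NormedSpace ℝ E]

/-- The signs of the functions `φ i` cut the bounded set `D` into cells whose closures are convex
polytopes on which all the `φ i` are affine; the `φ i` need not be affine on all of `D`. -/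
structure IsPolyhedralPartition (D : Set E) (φ : ι → E → ℝ) : Prop where
  bounded : Bornology.IsBounded D
  affine : ∀ x ∈ D, ∃ A : ι → E →ᵃ[ℝ] ℝ, (∀ y ∈ closedCell D φ x, ∀ i, φ i y = A i y) ∧
    ∀ y, IsFaceSign (fun i => SignType.sign (A i y)) (signVec φ x) → y ∈ closedCell D φ x

namespace IsPolyhedralPartition

variable {D : Set E} {φ : ι → E → ℝ}

theorem closedCell_eq (hD : IsPolyhedralPartition D φ) {x : E} (hx : x ∈ D) :
    ∃ A : ι → E →ᵃ[ℝ] ℝ, (∀ y ∈ closedCell D φ x, ∀ i, φ i y = A i y) ∧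
      closedCell D φ x =
        ⋂ i, A i ⁻¹' {r : ℝ | SignType.sign r = 0 ∨ SignType.sign r = signVec φ x i} := by
  obtain ⟨A, hA, hA'⟩ := hD.affine x hx
  refine ⟨A, hA, Set.Subset.antisymm (fun y hy => Set.mem_iInter.2 fun i => ?_) fun y hy => ?_⟩
  · have := hy.2 i
    simp only [signVec, hA y hy i] at this
    exact this
  · exact hA' y fun i => Set.mem_iInter.1 hy i

theorem convex_closedCell (hD : IsPolyhedralPartition D φ) {x : E} (hx : x ∈ D) :
    Convex ℝ (closedCell D φ x) := by
  obtain ⟨A, -, hA⟩ := hD.closedCell_eq hx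
  rw [hA]
  exact convex_iInter fun i => (convex_setOf_face_sign _).affine_preimage (A i)

theorem isCompact_closedCell [FiniteDimensional ℝ E] (hD : IsPolyhedralPartition D φ) {x : E}
    (hx : x ∈ D) : IsCompact (closedCell D φ x) := by
  refine Metric.isCompact_of_isClosed_isBounded ?_ (hD.bounded.subset fun y hy => hy.1)
  obtain ⟨A, -, hA⟩ := hD.closedCell_eq hx
  rw [hA]
  exact isClosed_iInter fun i =>
    (isClosed_setOf_face_sign _).preimage (A i).continuous_of_finiteDimensional

/-- The open cells are relatively open: moving from a point of the closed cell of `x` towards `x`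
leads at once into the open cell of `x`. -/
theorem signVec_combination (hD : IsPolyhedralPartition D φ) {x y : E} (hx : x ∈ D)
    (hy : y ∈ closedCell D φ x) {w w' : ℝ} (hw : 0 < w) (hw' : 0 ≤ w') (hww : w + w' = 1) :
    w • x + w' • y ∈ D ∧ signVec φ (w • x + w' • y) = signVec φ x ∧
      ∀ i, φ i (w • x + w' • y) = w * φ i x + w' * φ i y := by
  have hz := hD.convex_closedCell hx (self_mem_closedCell hx) hy hw.le hw' hww
  obtain ⟨A, hA, -⟩ := hD.affine x hx
  have hφ : ∀ i, φ i (w • x + w' • y) = w * φ i x + w' * φ i y := by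
    intro i
    rw [hA _ hz, hA _ hy, hA _ (self_mem_closedCell hx), Convex.combo_affine_apply hww]
    rfl
  refine ⟨hz.1, funext fun i => ?_, hφ⟩
  simp only [signVec, hφ]
  exact sign_convex_combination hw hw' (hy.2 i)

/-- The ray from `x` through another point `z` of its cell leaves the cell at a point `y` of a
smaller cell. -/
theorem exists_exit_point [FiniteDimensional ℝ E] [Finite ι] (hD : IsPolyhedralPartition D φ)
    {x z : E} (hx : x ∈ D) (hxz : signVec φ x = signVec φ z) (hne : x ≠ z) (hz : z ∈ D) :
    ∃ y ∈ closedCell D φ z, signVec φ y ≠ signVec φ z ∧ z ∈ segment ℝ x y := by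
  obtain ⟨A, hA, hA'⟩ := hD.affine z hz
  have hcpt := hD.isCompact_closedCell hz
  have hxc : x ∈ closedCell D φ z := ⟨hx, by rw [hxz]; exact IsFaceSign.refl _⟩
  let γ : ℝ →ᵃ[ℝ] E := AffineMap.lineMap x z
  have hγ : Continuous γ := AffineMap.lineMap_continuous
  let T : Set ℝ := γ ⁻¹' closedCell D φ z ∩ Set.Ici 1
  have hTne : (1 : ℝ) ∈ T :=
    ⟨by simpa [γ] using self_mem_closedCell hz, Set.mem_Ici.2 le_rfl⟩
  have hTc : IsCompact T := by
    refine Metric.isCompact_of_isClosed_isBounded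
      ((hcpt.isClosed.preimage hγ).inter isClosed_Ici) ?_
    obtain ⟨R, hR⟩ := hcpt.isBounded.exists_norm_le
    have hpos : 0 < ‖z - x‖ := norm_pos_iff.2 (sub_ne_zero.2 hne.symm)
    refine (Metric.isBounded_Icc (1 : ℝ) ((R + ‖x‖) / ‖z - x‖)).subset fun t ht => ⟨ht.2, ?_⟩
    have h1 := hR _ ht.1
    have h2 : ‖t • (z - x)‖ ≤ ‖γ t‖ + ‖x‖ := by
      have : t • (z - x) = γ t - x := by simp [γ, AffineMap.lineMap_apply]
      rw [this]
      exact norm_sub_le _ _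
    rw [norm_smul, Real.norm_eq_abs] at h2
    rw [le_div_iff₀ hpos]
    nlinarith [le_abs_self t]
  obtain ⟨t, ht, hmax⟩ := hTc.exists_isGreatest ⟨1, hTne⟩
  have ht1 : (1 : ℝ) ≤ t := ht.2
  refine ⟨γ t, ht.1, fun hsg => ?_, ?_⟩
  · -- otherwise the ray could be followed a bit further inside the cell
    have hev : ∀ᶠ u in nhds t, ∀ i,
        SignType.sign (A i (γ u)) = 0 ∨ SignType.sign (A i (γ u)) = signVec φ z i := by
      rw [Filter.eventually_all]
      intro i
      have hcont : Continuous fun u => A i (γ u) :=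
        (A i).continuous_of_finiteDimensional.comp hγ
      have hti : SignType.sign (A i (γ t)) = signVec φ z i := by
        rw [← hsg, signVec, hA _ ht.1]
      rcases lt_trichotomy (A i (γ t)) 0 with h | h | h
      · filter_upwards [hcont.continuousAt.eventually (gt_mem_nhds h)] with u hu
        right
        rw [← hti, sign_neg hu, sign_neg h]
      · refine Filter.Eventually.of_forall fun u => Or.inl ?_
        have hz0 : A i z = 0 := by
          rw [h, sign_zero] at hti
          have := hti.symm
          rwa [signVec, hA _ (self_mem_closedCell hz), sign_eq_zero_iff] at this
        have hx0 : A i x = 0 := by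
          rw [h, sign_zero] at hti
          have := hti.symm
          rwa [← hxz, signVec, hA _ hxc, sign_eq_zero_iff] at this
        simp [γ, AffineMap.apply_lineMap, hz0, hx0]
      · filter_upwards [hcont.continuousAt.eventually (lt_mem_nhds h)] with u hu
        right
        rw [← hti, sign_pos hu, sign_pos h]
    obtain ⟨ε, hε, hball⟩ := Metric.eventually_nhds_iff.1 hev
    have hmem : t + ε / 2 ∈ T := by
      refine ⟨hA' _ (hball ?_), ?_⟩
      · rw [Real.dist_eq, add_sub_cancel_left, abs_of_pos (by positivity)]
        linarith
      · exact Set.mem_Ici.2 (by linarith)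
    linarith [hmax hmem]
  · rw [segment_eq_image_lineMap]
    refine ⟨t⁻¹, ⟨by positivity, inv_le_one_of_one_le₀ ht1⟩, ?_⟩
    have : t ≠ 0 := by linarith
    simp [γ, AffineMap.lineMap_apply, smul_smul, this]

end IsPolyhedralPartition

namespace IsFlag

variable {D : Set E} {φ : ι → E → ℝ} {b : (ι → SignType) → E} {s t : Finset E}

/-- The top point of a flag is separated from the hull of the other points by one of the functions
that define the cells. -/
theorem exists_separating [Finite ι] [DecidableEq E] (hD : IsPolyhedralPartition D φ)
    (hs : IsFlag D φ b s) {x : E} (hx : x ∈ s) (htop : (s : Set E) ⊆ closedCell D φ x)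
    (hne : (s.erase x).Nonempty) :
    ∃ i, φ i x ≠ 0 ∧ ∀ y ∈ convexHull ℝ (s.erase x : Set E), φ i y = 0 := by
  have hs' := hs.mono (s.erase_subset x)
  obtain ⟨y, hy, hytop⟩ := hs'.exists_top hne
  have hys := Finset.mem_of_mem_erase hy
  have hyx : signVec φ y ≠ signVec φ x := fun h =>
    Finset.ne_of_mem_erase hy (by rw [← hs.chosen y hys, h, hs.chosen x hx])
  obtain ⟨i, hi⟩ := Function.ne_iff.1 hyx
  have hyi : signVec φ y i = 0 := ((htop hys).2 i).resolve_right hi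
  refine ⟨i, fun h => hi ?_, fun z hz => ?_⟩
  · rw [hyi, signVec, h, sign_zero]
  · have := (convexHull_min hytop (hD.convex_closedCell (hs.mem y hys)) hz).2 i
    rw [hyi, or_self] at this
    exact sign_eq_zero_iff.1 this

theorem affineIndependent [Finite ι] (hD : IsPolyhedralPartition D φ) (hs : IsFlag D φ b s) :
    AffineIndependent ℝ ((↑) : s → E) := by
  classical
  induction h : s.card generalizing s with
  | zero =>
    have : IsEmpty s := by
      rw [Finset.card_eq_zero.1 h]
      infer_instance
    exact affineIndependent_of_subsingleton _ _
  | succ n ih =>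
    obtain ⟨x, hx, htop⟩ := hs.exists_top (Finset.card_pos.1 (by omega))
    have ih' := ih (hs.mono (s.erase_subset x)) (by rw [Finset.card_erase_of_mem hx, h]; rfl)
    refine AffineIndependent.affineIndependent_of_notMem_span (i := ⟨x, hx⟩) ?_ ?_
    · let e : {y : s // y ≠ ⟨x, hx⟩} ↪ (s.erase x : Finset E) :=
        ⟨fun y => ⟨y.1.1, Finset.mem_erase.2 ⟨fun h => y.2 (Subtype.ext h), y.1.2⟩⟩,
          fun y z hyz => Subtype.ext (Subtype.ext (congrArg (fun u : (s.erase x : Finset E) => u.1) hyz))⟩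
      exact ih'.comp_embedding e
    · have himage : ((↑) : s → E) '' {y | y ≠ ⟨x, hx⟩} = (s.erase x : Set E) := by
        ext y
        simp only [Set.mem_image, Finset.coe_erase, Set.mem_sdiff, Finset.mem_coe,
          Set.mem_singleton_iff]
        constructor
        · rintro ⟨y, hy, rfl⟩
          exact ⟨y.2, fun h => hy (Subtype.ext h)⟩
        · rintro ⟨hy, hyx⟩
          exact ⟨⟨y, hy⟩, fun h => hyx (congrArg Subtype.val h), rfl⟩
      rw [himage]
      intro hmem
      rcases (s.erase x).eq_empty_or_nonempty with he | hne
      · rw [he, Finset.coe_empty, AffineSubspace.span_empty] at hmem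
        exact AffineSubspace.notMem_bot ℝ E x hmem
      obtain ⟨i, hi, h0⟩ := hs.exists_separating hD hx htop hne
      obtain ⟨A, hA, -⟩ := hD.affine x (hs.mem x hx)
      have hsub : A i '' (s.erase x : Set E) ⊆ {0} := by
        rintro _ ⟨y, hy, rfl⟩
        rw [Set.mem_singleton_iff, ← hA y (htop (Finset.mem_of_mem_erase hy))]
        exact h0 y (subset_convexHull ℝ _ hy)
      have h1 : A i x ∈ affineSpan ℝ (A i '' (s.erase x : Set E)) := by
        rw [← AffineSubspace.map_span]
        exact ⟨x, hmem, rfl⟩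
      have h2 := affineSpan_mono ℝ hsub h1
      rw [AffineSubspace.mem_affineSpan_singleton] at h2
      rw [hA x (htop hx)] at hi
      exact hi h2

/-- A point of the simplex of a flag lies in the simplex without the top point, or in the open cell
of the top point. -/
theorem mem_convexHull_cases [Finite ι] [DecidableEq E] (hD : IsPolyhedralPartition D φ)
    (hs : IsFlag D φ b s) {x : E} (hx : x ∈ s) (htop : (s : Set E) ⊆ closedCell D φ x) {z : E}
    (hz : z ∈ convexHull ℝ (s : Set E)) :
    z ∈ convexHull ℝ (s.erase x : Set E) ∨ signVec φ z = signVec φ x ∧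
      (z = x ∨ ∃ y ∈ convexHull ℝ (s.erase x : Set E), ∃ w : ℝ, 0 < w ∧ w < 1 ∧
        z = w • x + (1 - w) • y) := by
  have hxD := hs.mem x hx
  rcases (s.erase x).eq_empty_or_nonempty with he | hne
  · right
    have : z = x := by
      rw [← Finset.insert_erase hx, he] at hz
      simpa using hz
    exact ⟨by rw [this], Or.inl this⟩
  rw [← Finset.insert_erase hx, Finset.coe_insert, convexHull_insert (Finset.coe_nonempty.2 hne),
    mem_convexJoin] at hz
  obtain ⟨u, hu, y, hy, hseg⟩ := hz
  rw [Set.mem_singleton_iff.1 hu] at hseg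
  obtain ⟨w, w', hw, hw', hww, rfl⟩ := hseg
  rcases hw.eq_or_lt with rfl | hw
  · left
    have : w' = 1 := by linarith
    simpa [this] using hy
  right
  have hyc : y ∈ closedCell D φ x := convexHull_min
    (fun u hu => htop (Finset.mem_of_mem_erase hu)) (hD.convex_closedCell hxD) hy
  refine ⟨(hD.signVec_combination hxD hyc hw hw' hww).2.1, ?_⟩
  rcases hw'.eq_or_lt with rfl | hw'
  · left
    have : w = 1 := by linarith
    simp [this]
  · right
    exact ⟨y, hy, w, hw, by linarith, by rw [← hww]; simp⟩

theorem convexHull_inter_subset [Finite ι] (hD : IsPolyhedralPartition D φ)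
    (hs : IsFlag D φ b s) (ht : IsFlag D φ b t) {z : E} (hzs : z ∈ convexHull ℝ (s : Set E))
    (hzt : z ∈ convexHull ℝ (t : Set E)) : z ∈ convexHull ℝ (s ∩ t : Set E) := by
  classical
  induction h : s.card + t.card using Nat.strong_induction_on generalizing s t z with
  | _ n ih =>
  have hsne : s.Nonempty := Finset.coe_nonempty.1 (convexHull_nonempty_iff.1 ⟨z, hzs⟩)
  have htne : t.Nonempty := Finset.coe_nonempty.1 (convexHull_nonempty_iff.1 ⟨z, hzt⟩)
  obtain ⟨x, hx, hxtop⟩ := hs.exists_top hsne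
  obtain ⟨x', hx', hxtop'⟩ := ht.exists_top htne
  have hcs := Finset.card_erase_lt_of_mem hx
  have hct := Finset.card_erase_lt_of_mem hx'
  have hss : (s.erase x : Set E) ⊆ s := Finset.coe_subset.2 (s.erase_subset x)
  have htt : (t.erase x' : Set E) ⊆ t := Finset.coe_subset.2 (t.erase_subset x')
  rcases hs.mem_convexHull_cases hD hx hxtop hzs with hzs' | ⟨hsg, hzs'⟩
  · exact convexHull_mono (Set.inter_subset_inter_left _ hss)
      (ih _ (by omega) (hs.mono (s.erase_subset x)) ht hzs' hzt rfl)
  rcases ht.mem_convexHull_cases hD hx' hxtop' hzt with hzt' | ⟨hsg', hzt'⟩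
  · exact convexHull_mono (Set.inter_subset_inter_right _ htt)
      (ih _ (by omega) hs (ht.mono (t.erase_subset x')) hzs hzt' rfl)
  obtain rfl : x = x' := by
    rw [← hs.chosen x hx, ← ht.chosen x' hx', ← hsg, ← hsg']
  have hxst : x ∈ convexHull ℝ (s ∩ t : Set E) := subset_convexHull ℝ _ ⟨hx, hx'⟩
  rcases hzs' with rfl | ⟨y, hy, w, hw0, hw1, hzy⟩
  · exact hxst
  rcases hzt' with rfl | ⟨y', hy', w', hw0', hw1', hzy'⟩
  · exact hxst
  have hxD := hs.mem x hx
  have hyc : y ∈ closedCell D φ x :=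
    convexHull_min (hss.trans hxtop) (hD.convex_closedCell hxD) hy
  have hyc' : y' ∈ closedCell D φ x :=
    convexHull_min (htt.trans hxtop') (hD.convex_closedCell hxD) hy'
  -- the weight of the top point is determined by `z`: it is compared by the separating functions
  have weights : ∀ {i : ι} {y y' : E} {w w' : ℝ}, y ∈ closedCell D φ x → y' ∈ closedCell D φ x →
      0 < w → w < 1 → 0 < w' → w' < 1 → w • x + (1 - w) • y = w' • x + (1 - w') • y' →
      φ i x ≠ 0 → φ i y = 0 → w' ≤ w := by
    intro i y y' w w' hyc hyc' hw0 hw1 hw0' hw1' heq hix hiy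
    have e1 := (hD.signVec_combination hxD hyc hw0 (sub_nonneg.2 hw1.le) (by ring)).2.2 i
    have e2 := (hD.signVec_combination hxD hyc' hw0' (sub_nonneg.2 hw1'.le) (by ring)).2.2 i
    rw [heq, e2, hiy, mul_zero, add_zero] at e1
    have hface := hyc'.2 i
    simp only [signVec] at hface
    rcases lt_or_gt_of_ne hix with hneg | hpos
    · have : φ i y' ≤ 0 := by
        rw [← sign_nonpos_iff]
        rcases hface with h | h
        · rw [h]
        · rw [h, sign_nonpos_iff]
          exact hneg.le
      by_contra hlt
      push Not at hlt
      nlinarith [mul_nonpos_of_nonneg_of_nonpos (sub_nonneg.2 hw1'.le) this,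
        mul_neg_of_pos_of_neg (sub_pos.2 hlt) hneg]
    · have : 0 ≤ φ i y' := by
        rw [← sign_nonneg_iff]
        rcases hface with h | h
        · rw [h]
        · rw [h, sign_nonneg_iff]
          exact hpos.le
      by_contra hlt
      push Not at hlt
      nlinarith [mul_nonneg (sub_nonneg.2 hw1'.le) this, mul_pos (sub_pos.2 hlt) hpos]
  have hne : (s.erase x).Nonempty := Finset.coe_nonempty.1 (convexHull_nonempty_iff.1 ⟨y, hy⟩)
  have hne' : (t.erase x).Nonempty := Finset.coe_nonempty.1 (convexHull_nonempty_iff.1 ⟨y', hy'⟩)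
  obtain ⟨i, hi, hi0⟩ := hs.exists_separating hD hx hxtop hne
  obtain ⟨j, hj, hj0⟩ := ht.exists_separating hD hx' hxtop' hne'
  have heq := hzy.symm.trans hzy'
  obtain rfl : w = w' := le_antisymm
    (weights hyc' hyc hw0' hw1' hw0 hw1 heq.symm hj (hj0 y' hy'))
    (weights hyc hyc' hw0 hw1 hw0' hw1' heq hi (hi0 y hy))
  obtain rfl : y = y' := by
    have := add_left_cancel heq
    exact smul_right_injective E (sub_pos.2 hw1).ne' this
  have hyst := ih _ (by omega) (hs.mono (s.erase_subset x)) (ht.mono (t.erase_subset x)) hy hy' rfl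
  rw [hzy]
  exact convex_convexHull ℝ _ hxst (convexHull_mono (Set.inter_subset_inter hss htt) hyst)
    hw0.le (sub_nonneg.2 hw1.le) (by ring)

/-- The simplices of the flags cover `D`. -/
theorem exists_mem_convexHull [FiniteDimensional ℝ E] [Finite ι]
    (hD : IsPolyhedralPartition D φ)
    (hb : ∀ x ∈ D, b (signVec φ x) ∈ D ∧ signVec φ (b (signVec φ x)) = signVec φ x) {z : E}
    (hz : z ∈ D) : ∃ s : Finset E, s.Nonempty ∧ IsFlag D φ b s ∧
      (s : Set E) ⊆ closedCell D φ z ∧ z ∈ convexHull ℝ (s : Set E) := by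
  classical
  induction h : {i | signVec φ z i ≠ 0}.ncard using Nat.strong_induction_on generalizing z with
  | _ n ih =>
  obtain ⟨hxD, hxz⟩ := hb z hz
  set x := b (signVec φ z) with hxdef
  have hxc : x ∈ closedCell D φ z := ⟨hxD, by rw [hxz]; exact IsFaceSign.refl _⟩
  have hbx : b (signVec φ x) = x := by rw [hxz]
  by_cases hne : x = z
  · refine ⟨{x}, Finset.singleton_nonempty x, ⟨?_, ?_, ?_⟩, by simpa using hxc, by simp [hne]⟩
    · simpa using hxD
    · simpa using hbx
    · simp [IsFaceSign.refl]
  obtain ⟨y, hyc, hyz, hseg⟩ := hD.exists_exit_point hxD hxz hne hz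
  obtain ⟨s, hsne, hs, hsy, hys⟩ := ih _ (h ▸ hyc.2.ncard_lt hyz) hyc.1 rfl
  have hsz : ∀ u ∈ s, u ∈ closedCell D φ z := fun u hu =>
    ⟨hs.mem u hu, (hsy hu).2.trans hyc.2⟩
  refine ⟨insert x s, Finset.insert_nonempty x s, ⟨?_, ?_, ?_⟩, ?_, ?_⟩
  · simpa using ⟨hxD, hs.mem⟩
  · simpa using ⟨hbx, hs.chosen⟩
  · have hux : ∀ u ∈ s, IsFaceSign (signVec φ u) (signVec φ x) := fun u hu => by
      rw [hxz]
      exact (hsz u hu).2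
    intro u hu v hv
    rcases Finset.mem_insert.1 hu with rfl | hu <;> rcases Finset.mem_insert.1 hv with rfl | hv
    · exact Or.inl (IsFaceSign.refl _)
    · exact Or.inr (hux v hv)
    · exact Or.inl (hux u hu)
    · exact hs.chain u hu v hv
  · intro u hu
    rcases Finset.mem_insert.1 (Finset.mem_coe.1 hu) with rfl | hu
    exacts [hxc, hsz u hu]
  · rw [Finset.coe_insert]
    refine (convex_convexHull ℝ _).segment_subset (subset_convexHull ℝ _ (Set.mem_insert _ _))
      (convexHull_mono (Set.subset_insert _ _) hys) hseg

end IsFlag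

/-- The derived subdivision of a polyhedral partition, for given points `b σ` of the open cells: its
simplices are spanned by the flags. -/
def derivedSubdivision [Finite ι] {D : Set E} {φ : ι → E → ℝ} (hD : IsPolyhedralPartition D φ)
    (b : (ι → SignType) → E) : Geometry.SimplicialComplex ℝ E where
  faces := {s | s.Nonempty ∧ IsFlag D φ b s}
  isRelLowerSet_faces := fun _ hs => ⟨hs.1, fun _ hts ht => ⟨ht, hs.2.mono hts⟩⟩
  indep := fun hs => hs.2.affineIndependent hD
  inter_subset_convexHull := fun hs ht _ hz => hs.2.convexHull_inter_subset hD ht.2 hz.1 hz.2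

theorem isSubdivision_derivedSubdivision [FiniteDimensional ℝ E] [Finite ι] {c : Set (Set E)}
    {φ : ι → E → ℝ} (hD : IsPolyhedralPartition (⋃₀ c) φ) {b : (ι → SignType) → E}
    (hb : ∀ x ∈ ⋃₀ c, b (signVec φ x) ∈ ⋃₀ c ∧ signVec φ (b (signVec φ x)) = signVec φ x)
    (hc : ∀ s ∈ c, ∀ x ∈ s, closedCell (⋃₀ c) φ x ⊆ s) :
    IsSubdivision (derivedSubdivision hD b) c := by
  have hcell : ∀ s ∈ (derivedSubdivision hD b).faces, ∃ t ∈ c, convexHull ℝ (s : Set E) ⊆ t := by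
    rintro s ⟨hne, hs⟩
    obtain ⟨x, hx, htop⟩ := hs.exists_top hne
    obtain ⟨t, ht, hxt⟩ := hs.mem x hx
    exact ⟨t, ht, (convexHull_min htop (hD.convex_closedCell (hs.mem x hx))).trans (hc t ht x hxt)⟩
  refine ⟨?_, ?_, hcell⟩
  · have hfin : (Set.range b).Finite := Set.finite_range b
    refine (hfin.toFinset.powerset.finite_toSet).subset fun s hs => ?_
    rw [Finset.mem_coe, Finset.mem_powerset]
    intro x hx
    rw [Set.Finite.mem_toFinset]
    exact ⟨_, hs.2.chosen x hx⟩
  · refine Set.Subset.antisymm (fun z hz => ?_) fun z hz => ?_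
    · obtain ⟨s, hs, hzs⟩ := Geometry.SimplicialComplex.mem_space_iff.1 hz
      obtain ⟨t, ht, hst⟩ := hcell s hs
      exact ⟨t, ht, hst hzs⟩
    · obtain ⟨s, hne, hs, -, hzs⟩ := IsFlag.exists_mem_convexHull hD hb hz
      exact Geometry.SimplicialComplex.mem_space_iff.2 ⟨s, ⟨hne, hs⟩, hzs⟩

end DerivedSubdivision

/-! ### Piecewise linear maps are simplicial for suitable subdivisions -/

section Triangulation

variable {E F : Type*} [NormedAddCommGroup E] [NormedSpace ℝ E]
  [NormedAddCommGroup F] [NormedSpace ℝ F]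

/-- A bounded intersection of finitely many closed half-spaces. -/
def IsPolytope (s : Set E) : Prop :=
  Bornology.IsBounded s ∧ ∃ 𝒜 : Set (E →ᵃ[ℝ] ℝ), 𝒜.Finite ∧ s = {x | ∀ a ∈ 𝒜, 0 ≤ a x}

theorem IsPolytope.isSemilinear {s : Set E} (hs : IsPolytope s) : IsSemilinear s := by
  obtain ⟨-, 𝒜, h𝒜, rfl⟩ := hs
  exact isSemilinear_setOf_forall_nonneg h𝒜

theorem IsPolytope.isClosed [FiniteDimensional ℝ E] {s : Set E} (hs : IsPolytope s) :
    IsClosed s := by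
  obtain ⟨-, 𝒜, -, rfl⟩ := hs
  have : {x | ∀ a ∈ 𝒜, 0 ≤ a x} = ⋂ a ∈ 𝒜, a ⁻¹' Set.Ici (0 : ℝ) := by
    ext x
    simp
  rw [this]
  exact isClosed_biInter fun a _ => isClosed_Ici.preimage a.continuous_of_finiteDimensional

/-- A finite family of polytopes is defined by inequalities from one finite arrangement. -/
theorem exists_arrangement_of_isPolytope {c : Set (Set E)} (hc : c.Finite)
    (h : ∀ s ∈ c, IsPolytope s) : ∃ 𝒜 : Set (E →ᵃ[ℝ] ℝ), 𝒜.Finite ∧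
      ∀ s ∈ c, ∃ 𝒜' ⊆ 𝒜, s = {x | ∀ a ∈ 𝒜', 0 ≤ a x} := by
  have h' := fun s hs => (h s hs).2
  choose! 𝒜 h𝒜 hs using h'
  exact ⟨⋃ s ∈ c, 𝒜 s, hc.biUnion h𝒜, fun s hsc =>
    ⟨𝒜 s, Set.subset_biUnion_of_mem (u := 𝒜) hsc, hs s hsc⟩⟩

/-- The functions whose signs give the common refinement of the cells of `𝒜` with the preimages
under `f` of the cells of `ℬ`. -/
def refinedFunctions (𝒜 : Set (E →ᵃ[ℝ] ℝ)) (ℬ : Set (F →ᵃ[ℝ] ℝ)) (f : E → F) :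
    𝒜 ⊕ ℬ → E → ℝ :=
  Sum.elim (fun a x => a.1 x) fun b x => b.1 (f x)

variable {𝒜 : Set (E →ᵃ[ℝ] ℝ)} {ℬ : Set (F →ᵃ[ℝ] ℝ)} {f : E → F} {c : Set (Set E)}

theorem mem_of_isFaceSign (hc : ∀ s ∈ c, ∃ 𝒜' ⊆ 𝒜, s = {x | ∀ a ∈ 𝒜', 0 ≤ a x}) {x y : E}
    (hxy : ∀ a ∈ 𝒜, SignType.sign (a y) = 0 ∨ SignType.sign (a y) = SignType.sign (a x))
    {s : Set E} (hs : s ∈ c) (hx : x ∈ s) : y ∈ s := by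
  obtain ⟨𝒜', h𝒜', rfl⟩ := hc s hs
  intro a ha
  rw [← sign_nonneg_iff]
  rcases hxy a (h𝒜' ha) with h | h
  · rw [h]
  · rw [h, sign_nonneg_iff]
    exact hx a ha

/-- A continuous function that agrees with an affine map on an open cell does so on the closed
cell. -/
theorem eq_of_isFaceSign [FiniteDimensional ℝ E]
    (hc : ∀ s ∈ c, ∃ 𝒜' ⊆ 𝒜, s = {x | ∀ a ∈ 𝒜', 0 ≤ a x}) (hf : ContinuousOn f (⋃₀ c))
    {x y : E} (hx : x ∈ ⋃₀ c)
    (hxy : ∀ a ∈ 𝒜, SignType.sign (a y) = 0 ∨ SignType.sign (a y) = SignType.sign (a x))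
    {A : E →ᵃ[ℝ] F} (hA : ∀ z ∈ ⋃₀ c, SameSigns 𝒜 x z → f z = A z) : f y = A y := by
  obtain ⟨s, hs, hxs⟩ := hx
  let γ : ℝ →ᵃ[ℝ] E := AffineMap.lineMap y x
  have hγ : Continuous γ := AffineMap.lineMap_continuous
  have hsign : ∀ t ∈ Set.Ioc (0 : ℝ) 1, SameSigns 𝒜 x (γ t) := by
    intro t ht a ha
    have : a (γ t) = t * a x + (1 - t) * a y := by
      rw [show a (γ t) = AffineMap.lineMap (a y) (a x) t from a.apply_lineMap y x t,
        AffineMap.lineMap_apply_module, smul_eq_mul, smul_eq_mul, add_comm]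
    rw [this, sign_convex_combination ht.1 (sub_nonneg.2 ht.2) (hxy a ha)]
  have hmem : ∀ t ∈ Set.Ioc (0 : ℝ) 1, γ t ∈ ⋃₀ c := fun t ht =>
    ⟨s, hs, mem_of_isFaceSign hc (fun a ha => Or.inr (hsign t ht a ha).symm) hs hxs⟩
  have hy : y ∈ ⋃₀ c := ⟨s, hs, mem_of_isFaceSign hc hxy hs hxs⟩
  have hγ0 : Filter.Tendsto γ (nhdsWithin 0 (Set.Ioc 0 1)) (nhdsWithin y (⋃₀ c)) := by
    refine tendsto_nhdsWithin_iff.2 ⟨?_, eventually_mem_nhdsWithin.mono hmem⟩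
    have := (hγ.tendsto 0).mono_left (nhdsWithin_le_nhds (s := Set.Ioc (0 : ℝ) 1))
    simpa [γ] using this
  have : (nhdsWithin (0 : ℝ) (Set.Ioc 0 1)).NeBot := by
    rw [nhdsWithin_Ioc_eq_nhdsGT one_pos]
    infer_instance
  have h1 := (hf y hy).tendsto.comp hγ0
  have h2 : Filter.Tendsto (fun t => A (γ t)) (nhdsWithin 0 (Set.Ioc 0 1)) (nhds (A y)) := by
    have := ((A.continuous_of_finiteDimensional.comp hγ).tendsto 0).mono_left
      (nhdsWithin_le_nhds (s := Set.Ioc (0 : ℝ) 1))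
    simpa [γ, Function.comp_def] using this
  refine tendsto_nhds_unique h1 (h2.congr' ?_)
  filter_upwards [eventually_mem_nhdsWithin] with t ht
  exact (hA _ (hmem t ht) (hsign t ht)).symm

theorem isPolyhedralPartition_refinedFunctions [FiniteDimensional ℝ E]
    (hc : ∀ s ∈ c, ∃ 𝒜' ⊆ 𝒜, s = {x | ∀ a ∈ 𝒜', 0 ≤ a x}) (hb : Bornology.IsBounded (⋃₀ c))
    (hf : ContinuousOn f (⋃₀ c))
    (hA : ∀ x ∈ ⋃₀ c, ∃ A : E →ᵃ[ℝ] F, ∀ y ∈ ⋃₀ c, SameSigns 𝒜 x y → f y = A y) :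
    IsPolyhedralPartition (⋃₀ c) (refinedFunctions 𝒜 ℬ f) := by
  refine ⟨hb, fun x hx => ?_⟩
  obtain ⟨A, hA⟩ := hA x hx
  refine ⟨Sum.elim (fun a => a.1) fun b => b.1.comp A, ?_, ?_⟩
  · rintro y ⟨-, hyx⟩ (a | b)
    · rfl
    · have := eq_of_isFaceSign hc hf hx (fun a ha => hyx (Sum.inl ⟨a, ha⟩)) hA
      simp [refinedFunctions, this]
  · intro y hy
    have hxy : ∀ a ∈ 𝒜, SignType.sign (a y) = 0 ∨ SignType.sign (a y) = SignType.sign (a x) :=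
      fun a ha => hy (Sum.inl ⟨a, ha⟩)
    have hfy := eq_of_isFaceSign hc hf hx hxy hA
    obtain ⟨s, hs, hxs⟩ := hx
    refine ⟨⟨s, hs, mem_of_isFaceSign hc hxy hs hxs⟩, ?_⟩
    rintro (a | b)
    · exact hy (Sum.inl a)
    · have := hy (Sum.inr b)
      simpa [signVec, refinedFunctions, hfy] using this

theorem closedCell_refinedFunctions_subset
    (hc : ∀ s ∈ c, ∃ 𝒜' ⊆ 𝒜, s = {x | ∀ a ∈ 𝒜', 0 ≤ a x}) {s : Set E} (hs : s ∈ c) {x : E}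
    (hx : x ∈ s) : closedCell (⋃₀ c) (refinedFunctions 𝒜 ℬ f) x ⊆ s := fun _ hy =>
  mem_of_isFaceSign hc (fun a ha => hy.2 (Sum.inl ⟨a, ha⟩)) hs hx

/-- A continuous piecewise affine map between polyhedra is simplicial for suitable subdivisions.
The target is cut by an arrangement `ℬ` that contains the images of the cells of an arrangement
`𝒜` for `f`, and the source by `𝒜` and the preimages of the cells of `ℬ`. Then `f` maps open cells
onto open cells, so the points that define the two derived subdivisions can be chosen compatibly. -/
theorem PLOn.isPLBetween [FiniteDimensional ℝ E] [FiniteDimensional ℝ F] {d : Set (Set F)}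
    (hf : PLOn f (⋃₀ c)) (hfin : c.Finite) (hc : ∀ s ∈ c, IsPolytope s)
    (hfin' : d.Finite) (hd : ∀ s ∈ d, IsPolytope s) (hm : Set.MapsTo f (⋃₀ c) (⋃₀ d)) :
    IsPLBetween c d f := by
  classical
  obtain ⟨hcont, 𝒜₀, ℳ, h𝒜₀, -, hA⟩ := hf
  obtain ⟨𝒜₁, h𝒜₁, hc𝒜₁⟩ := exists_arrangement_of_isPolytope hfin hc
  obtain ⟨ℬ₁, hℬ₁, hdℬ₁⟩ := exists_arrangement_of_isPolytope hfin' hd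
  let 𝒜 := 𝒜₀ ∪ 𝒜₁
  have h𝒜 : 𝒜.Finite := h𝒜₀.union h𝒜₁
  have hA' : ∀ x ∈ ⋃₀ c, ∃ A : E →ᵃ[ℝ] F, ∀ y ∈ ⋃₀ c, SameSigns 𝒜 x y → f y = A y := by
    intro x hx
    obtain ⟨A, -, hA⟩ := hA x hx
    exact ⟨A, fun y hy hxy => hA y hy (hxy.mono Set.subset_union_left)⟩
  have hc𝒜 : ∀ s ∈ c, ∃ 𝒜' ⊆ 𝒜, s = {x | ∀ a ∈ 𝒜', 0 ≤ a x} := by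
    intro s hs
    obtain ⟨𝒜', h, rfl⟩ := hc𝒜₁ s hs
    exact ⟨𝒜', h.trans Set.subset_union_right, rfl⟩
  have hcsl : IsSemilinear (⋃₀ c) := IsSemilinear.sUnion hfin fun s hs => (hc s hs).isSemilinear
  obtain ⟨ℬ₀, hℬ₀, himg⟩ : ∃ ℬ₀ : Set (F →ᵃ[ℝ] ℝ), ℬ₀.Finite ∧
      ∀ x ∈ ⋃₀ c, IsUnionOfCells ℬ₀ (f '' {y ∈ ⋃₀ c | SameSigns 𝒜 x y}) := by
    obtain ⟨ℬ₀, hℬ₀, h⟩ := exists_common_arrangement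
      (c := (fun x => f '' {y ∈ ⋃₀ c | SameSigns 𝒜 x y}) '' ⋃₀ c) (by
        refine ((finite_range_cells h𝒜 (⋃₀ c)).image (Set.image f)).subset ?_
        rintro _ ⟨x, -, rfl⟩
        exact ⟨_, ⟨x, rfl⟩, rfl⟩) (by
        rintro _ ⟨x, hx, rfl⟩
        obtain ⟨A, hA⟩ := hA' x hx
        have : f '' {y ∈ ⋃₀ c | SameSigns 𝒜 x y} = A '' (⋃₀ c ∩ {y | SameSigns 𝒜 x y}) :=
          Set.image_congr fun y hy => hA y hy.1 hy.2
        simp only [this]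
        exact (hcsl.inter ⟨𝒜, h𝒜, isUnionOfCells_sameSigns 𝒜 x⟩).image A)
    exact ⟨ℬ₀, hℬ₀, fun x hx => h _ ⟨x, hx, rfl⟩⟩
  let ℬ := ℬ₀ ∪ ℬ₁
  have hℬ : ℬ.Finite := hℬ₀.union hℬ₁
  have hdℬ : ∀ s ∈ d, ∃ ℬ' ⊆ ℬ, s = {x | ∀ a ∈ ℬ', 0 ≤ a x} := by
    intro s hs
    obtain ⟨ℬ', h, rfl⟩ := hdℬ₁ s hs
    exact ⟨ℬ', h.trans Set.subset_union_right, rfl⟩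
  have := h𝒜.to_subtype
  have := hℬ.to_subtype
  let φ := refinedFunctions 𝒜 ℬ f
  let ψ := refinedFunctions ℬ (∅ : Set (F →ᵃ[ℝ] ℝ)) id
  have hφ : IsPolyhedralPartition (⋃₀ c) φ := isPolyhedralPartition_refinedFunctions hc𝒜
    ((Bornology.isBounded_sUnion hfin).2 fun s hs => (hc s hs).1) hcont hA'
  have hψ : IsPolyhedralPartition (⋃₀ d) ψ := isPolyhedralPartition_refinedFunctions hdℬ
    ((Bornology.isBounded_sUnion hfin').2 fun s hs => (hd s hs).1) continuousOn_id
    fun x hx => ⟨AffineMap.id ℝ F, fun y hy hxy => rfl⟩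
  -- the cells of `φ` lie over those of `ψ`
  have hface : ∀ x y, IsFaceSign (signVec φ x) (signVec φ y) →
      IsFaceSign (signVec ψ (f x)) (signVec ψ (f y)) := by
    rintro x y h (b | b)
    · exact h (Sum.inr b)
    · exact b.2.elim
  have hover : ∀ x y, signVec φ x = signVec φ y → signVec ψ (f x) = signVec ψ (f y) := by
    rintro x y h
    funext b
    rcases b with b | b
    · exact congrFun h (Sum.inr b)
    · exact b.2.elim
  have hpt : ∀ τ, ∃ p, ∀ y ∈ ⋃₀ d, signVec ψ y = τ → p ∈ ⋃₀ d ∧ signVec ψ p = τ := by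
    intro τ
    by_cases h : ∃ y ∈ ⋃₀ d, signVec ψ y = τ
    · obtain ⟨y, hy, hyτ⟩ := h
      exact ⟨y, fun _ _ _ => ⟨hy, hyτ⟩⟩
    · exact ⟨0, fun y hy hyτ => absurd ⟨y, hy, hyτ⟩ h⟩
  choose q hq using hpt
  have hpt' : ∀ σ, ∃ p, ∀ x ∈ ⋃₀ c, signVec φ x = σ →
      p ∈ ⋃₀ c ∧ signVec φ p = σ ∧ f p = q (signVec ψ (f x)) := by
    intro σ
    by_cases h : ∃ x ∈ ⋃₀ c, signVec φ x = σ
    · obtain ⟨x, hx, hxσ⟩ := h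
      obtain ⟨-, hqx⟩ := hq _ (f x) (hm hx) rfl
      have hsame : SameSigns ℬ (f x) (q (signVec ψ (f x))) := fun b hb =>
        (congrFun hqx (Sum.inl ⟨b, hb⟩)).symm
      obtain ⟨p, ⟨hpc, hxp⟩, hfp⟩ := himg x hx (f x) ⟨x, ⟨hx, SameSigns.refl _ _⟩, rfl⟩ _
        (hsame.mono Set.subset_union_left)
      have hpσ : signVec φ p = σ := by
        rw [← hxσ]
        funext i
        rcases i with a | b
        · exact (hxp a.1 a.2).symm
        · have := hsame b.1 b.2
          rw [← hfp] at this
          exact this.symm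
      refine ⟨p, fun y _ hyσ => ⟨hpc, hpσ, ?_⟩⟩
      rw [hfp, hover x y (hxσ.trans hyσ.symm)]
    · exact ⟨0, fun x hx hxσ => absurd ⟨x, hx, hxσ⟩ h⟩
  choose p hp using hpt'
  refine ⟨derivedSubdivision hφ p, derivedSubdivision hψ q,
    isSubdivision_derivedSubdivision hφ (fun x hx => ?_)
      (fun s hs x hx => closedCell_refinedFunctions_subset hc𝒜 hs hx),
    isSubdivision_derivedSubdivision hψ (fun y hy => hq _ y hy rfl)
      (fun s hs x hx => closedCell_refinedFunctions_subset hdℬ hs hx), ?_⟩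
  · obtain ⟨h1, h2, -⟩ := hp _ x hx rfl
    exact ⟨h1, h2⟩
  rintro s ⟨hsne, hs⟩
  refine ⟨⟨s.image f, ⟨hsne.image f, ⟨?_, ?_, ?_⟩⟩, by simp⟩, ?_⟩
  · intro y hy
    obtain ⟨x, hx, rfl⟩ := Finset.mem_image.1 hy
    exact hm (hs.mem x hx)
  · intro y hy
    obtain ⟨x, hx, rfl⟩ := Finset.mem_image.1 hy
    have := (hp _ x (hs.mem x hx) rfl).2.2
    rw [hs.chosen x hx] at this
    exact this.symm
  · intro y hy y' hy'
    obtain ⟨x, hx, rfl⟩ := Finset.mem_image.1 hy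
    obtain ⟨x', hx', rfl⟩ := Finset.mem_image.1 hy'
    exact (hs.chain x hx x' hx').imp (hface x x') (hface x' x)
  · obtain ⟨x, hx, htop⟩ := hs.exists_top hsne
    obtain ⟨A, hA⟩ := hA' x (hs.mem x hx)
    refine ⟨A, fun z hz => ?_⟩
    have hzx := convexHull_min htop (hφ.convex_closedCell (hs.mem x hx)) hz
    exact eq_of_isFaceSign hc𝒜 hcont (hs.mem x hx) (fun a ha => hzx.2 (Sum.inl ⟨a, ha⟩)) hA

theorem isSemilinear_stdSimplex (ι : Type*) [Fintype ι] : IsSemilinear (stdSimplex ℝ ι) := by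
  have h1 : IsSemilinear {x : ι → ℝ | ∀ a ∈ Set.range fun i =>
      (LinearMap.proj (R := ℝ) (φ := fun _ : ι => ℝ) i).toAffineMap, 0 ≤ a x} :=
    isSemilinear_setOf_forall_nonneg (Set.finite_range _)
  have h2 := isSemilinear_eq
    (∑ i, LinearMap.proj (R := ℝ) (φ := fun _ : ι => ℝ) i).toAffineMap (AffineMap.const ℝ _ 1)
  convert h1.inter h2 using 1
  ext x
  simp [stdSimplex]

theorem isSemilinear_convexHull [FiniteDimensional ℝ E] (s : Finset E) :
    IsSemilinear (convexHull ℝ (s : Set E)) := by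
  classical
  rw [s.finite_toSet.convexHull_eq_image]
  have := @isSemilinear_stdSimplex (s : Set E) s.finite_toSet.fintype
  exact this.image (LinearMap.toAffineMap _)

theorem IsPLBetween.plOn [FiniteDimensional ℝ E] {d : Set (Set F)} (h : IsPLBetween c d f) :
    PLOn f (⋃₀ c) := by
  obtain ⟨S, T, ⟨hfin, hS, -⟩, -, hf⟩ := h
  have : ⋃₀ c = ⋃₀ ((fun s : Finset E => convexHull ℝ (s : Set E)) '' S.faces) := by
    rw [← hS, Set.sUnion_image]
    rfl
  rw [this]
  refine plOn_sUnion (hfin.image _) ?_ ?_ ?_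
  · rintro _ ⟨s, hs, rfl⟩
    obtain ⟨A, hA⟩ := (hf s hs).2
    exact (A.plOn _).congr hA
  · rintro _ ⟨s, -, rfl⟩
    exact (s.finite_toSet.isCompact_convexHull (𝕜 := ℝ)).isClosed
  · rintro _ ⟨s, -, rfl⟩
    exact isSemilinear_convexHull s

theorem IsPLBetween.mapsTo {d : Set (Set F)} (h : IsPLBetween c d f) :
    Set.MapsTo f (⋃₀ c) (⋃₀ d) := by
  obtain ⟨S, T, ⟨-, hS, -⟩, ⟨-, hT, -⟩, hf⟩ := h
  intro x hx
  rw [← hS] at hx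
  obtain ⟨s, hs, hxs⟩ := Geometry.SimplicialComplex.mem_space_iff.1 hx
  obtain ⟨⟨t, ht, hst⟩, A, hA⟩ := hf s hs
  rw [← hT]
  refine Geometry.SimplicialComplex.mem_space_iff.2 ⟨t, ht, ?_⟩
  rw [← hst, Set.image_congr fun y hy => hA (subset_convexHull ℝ _ hy),
    ← AffineMap.image_convexHull, hA hxs]
  exact ⟨x, hxs, rfl⟩

end Triangulation

/-! ### Bodies and the maps induced by simplicial maps -/

section Bodies

set_option linter.unusedSectionVars false

variable {V W T : Type*} [Fintype V] [DecidableEq V] [Fintype W] [DecidableEq W]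
  [Fintype T] [DecidableEq T]

theorem mem_simplexOf {σ : Finset V} {x : V → ℝ} :
    x ∈ simplexOf σ ↔ (∀ v, 0 ≤ x v) ∧ ∑ v, x v = 1 ∧ ∀ v ∉ σ, x v = 0 := by
  constructor
  · intro hx
    have hconv : Convex ℝ {x : V → ℝ | (∀ v, 0 ≤ x v) ∧ ∑ v, x v = 1 ∧ ∀ v ∉ σ, x v = 0} := by
      rintro x ⟨hx, hx1, hxσ⟩ y ⟨hy, hy1, hyσ⟩ a b ha hb hab
      refine ⟨fun v => ?_, ?_, fun v hv => ?_⟩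
      · exact add_nonneg (mul_nonneg ha (hx v)) (mul_nonneg hb (hy v))
      · simp [Finset.sum_add_distrib, ← Finset.mul_sum, hx1, hy1, hab]
      · simp [hxσ v hv, hyσ v hv]
    refine convexHull_min ?_ hconv hx
    rintro _ ⟨v, hv, rfl⟩
    refine ⟨fun w => ?_, by simp, fun w hw => ?_⟩
    · by_cases h : w = v
      · subst h
        simp
      · simp [h]
    · have : w ≠ v := fun h => hw (h ▸ hv)
      simp [this]
  · rintro ⟨hx, hx1, hxσ⟩
    have hsum : ∑ v ∈ σ, x v = 1 := by
      rw [← hx1]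
      exact Finset.sum_subset (Finset.subset_univ _) fun v _ hv => hxσ v hv
    have : x = ∑ v ∈ σ, x v • (Pi.single v 1 : V → ℝ) := by
      ext w
      simp only [Finset.sum_apply, Pi.smul_apply, Pi.single_apply, smul_eq_mul, mul_ite, mul_one,
        mul_zero, Finset.sum_ite_eq]
      split_ifs with h
      · rfl
      · exact hxσ w h
    rw [this]
    exact (convex_convexHull ℝ _).sum_mem (fun v _ => hx v) hsum
      fun v hv => subset_convexHull ℝ _ ⟨v, hv, rfl⟩

theorem isPolytope_simplexOf (σ : Finset V) : IsPolytope (simplexOf σ) := by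
  constructor
  · exact (((σ.finite_toSet.image _).isCompact_convexHull (𝕜 := ℝ))).isBounded
  · let p : V → (V → ℝ) →ᵃ[ℝ] ℝ := fun v =>
      (LinearMap.proj (R := ℝ) (φ := fun _ : V => ℝ) v).toAffineMap
    let S : (V → ℝ) →ᵃ[ℝ] ℝ :=
      (∑ v, LinearMap.proj (R := ℝ) (φ := fun _ : V => ℝ) v).toAffineMap
    have hp : ∀ v x, p v x = x v := fun v x => rfl
    have hS : ∀ x, S x = ∑ v, x v := fun x => by simp [S]
    let q : (V → ℝ) →ᵃ[ℝ] ℝ := AffineMap.const ℝ _ 1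
    refine ⟨Set.range p ∪ ((fun v => -p v) '' (σ : Set V)ᶜ ∪ {S - q, q - S}),
      (Set.finite_range p).union (((Set.toFinite _).image _).union (by simp)), ?_⟩
    ext x
    rw [mem_simplexOf]
    constructor
    · rintro ⟨h0, h1, hσ⟩ a (⟨v, rfl⟩ | ⟨v, hv, rfl⟩ | rfl | rfl)
      · exact h0 v
      · simp [hp, hσ v (by simpa using hv)]
      · simp [hS, h1, q]
      · simp [hS, h1, q]
    · intro h
      have h0 : ∀ v, 0 ≤ x v := fun v => h _ (Or.inl ⟨v, rfl⟩)
      refine ⟨h0, le_antisymm ?_ ?_, fun v hv => le_antisymm ?_ (h0 v)⟩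
      · have := h _ (Or.inr (Or.inr (Or.inr rfl)))
        simpa [hS, q] using this
      · have := h _ (Or.inr (Or.inr (Or.inl rfl)))
        simpa [hS, q] using this
      · have := h _ (Or.inr (Or.inl ⟨v, by simpa using hv, rfl⟩))
        simpa [hp] using this

theorem isPolytope_prism (σ : Finset V) :
    IsPolytope (simplexOf σ ×ˢ Set.Icc (0 : ℝ) 1) := by
  obtain ⟨hb, 𝒜, h𝒜, hσ⟩ := isPolytope_simplexOf σ
  refine ⟨hb.prod (Metric.isBounded_Icc 0 1), ?_⟩
  let fst : (V → ℝ) × ℝ →ᵃ[ℝ] (V → ℝ) := (LinearMap.fst ℝ (V → ℝ) ℝ).toAffineMap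
  let snd : (V → ℝ) × ℝ →ᵃ[ℝ] ℝ := (LinearMap.snd ℝ (V → ℝ) ℝ).toAffineMap
  let q : (V → ℝ) × ℝ →ᵃ[ℝ] ℝ := AffineMap.const ℝ _ 1
  refine ⟨(fun a => a.comp fst) '' 𝒜 ∪ {snd, q - snd}, (h𝒜.image _).union (by simp), ?_⟩
  ext ⟨x, t⟩
  rw [hσ]
  simp [fst, snd, q, or_imp, forall_and]
  tauto

theorem FinComplex.finite_cells (K : FinComplex V) : K.cells.Finite := by
  refine (K.faces.finite_toSet.image simplexOf).subset ?_
  rintro _ ⟨σ, hσ, rfl⟩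
  exact ⟨σ, hσ, rfl⟩

theorem FinComplex.finite_prismCells (K : FinComplex V) : K.prismCells.Finite := by
  refine (K.faces.finite_toSet.image fun σ => simplexOf σ ×ˢ Set.Icc (0 : ℝ) 1).subset ?_
  rintro _ ⟨σ, hσ, rfl⟩
  exact ⟨σ, hσ, rfl⟩

theorem FinComplex.isPolytope_of_mem_cells (K : FinComplex V) : ∀ s ∈ K.cells, IsPolytope s := by
  rintro _ ⟨σ, -, rfl⟩
  exact isPolytope_simplexOf σ

theorem FinComplex.isPolytope_of_mem_prismCells (K : FinComplex V) :
    ∀ s ∈ K.prismCells, IsPolytope s := by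
  rintro _ ⟨σ, -, rfl⟩
  exact isPolytope_prism σ

theorem FinComplex.sUnion_prismCells (K : FinComplex V) :
    ⋃₀ K.prismCells = K.body ×ˢ Set.Icc (0 : ℝ) 1 := by
  ext ⟨x, t⟩
  constructor
  · rintro ⟨_, ⟨σ, hσ, rfl⟩, hx, ht⟩
    exact ⟨⟨_, ⟨σ, hσ, rfl⟩, hx⟩, ht⟩
  · rintro ⟨⟨_, ⟨σ, hσ, rfl⟩, hx⟩, ht⟩
    exact ⟨_, ⟨σ, hσ, rfl⟩, hx, ht⟩

theorem FinComplex.isSemilinear_body (K : FinComplex V) : IsSemilinear K.body :=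
  IsSemilinear.sUnion K.finite_cells fun s hs => (K.isPolytope_of_mem_cells s hs).isSemilinear

theorem FinComplex.isClosed_body (K : FinComplex V) : IsClosed K.body := by
  rw [FinComplex.body, Set.sUnion_eq_biUnion]
  exact K.finite_cells.isClosed_biUnion fun s hs => (K.isPolytope_of_mem_cells s hs).isClosed

theorem isPLMap_iff {K : FinComplex V} {L : FinComplex W} {f : (V → ℝ) → (W → ℝ)} :
    IsPLMap K L f ↔ PLOn f K.body ∧ Set.MapsTo f K.body L.body :=
  ⟨fun h => ⟨h.plOn, h.mapsTo⟩, fun h => h.1.isPLBetween K.finite_cells K.isPolytope_of_mem_cells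
    L.finite_cells L.isPolytope_of_mem_cells h.2⟩

theorem plHomotopic_iff {K : FinComplex V} {L : FinComplex W} {f₀ f₁ : (V → ℝ) → (W → ℝ)} :
    PLHomotopic K L f₀ f₁ ↔ ∃ H : (V → ℝ) × ℝ → (W → ℝ), PLOn H (K.body ×ˢ Set.Icc 0 1) ∧
      Set.MapsTo H (K.body ×ˢ Set.Icc 0 1) L.body ∧
      ∀ x ∈ K.body, H (x, 0) = f₀ x ∧ H (x, 1) = f₁ x := by
  refine exists_congr fun H => ?_
  rw [← and_assoc, ← K.sUnion_prismCells]
  exact and_congr_left' ⟨fun h => ⟨h.plOn, h.mapsTo⟩, fun h => h.1.isPLBetween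
    K.finite_prismCells K.isPolytope_of_mem_prismCells L.finite_cells L.isPolytope_of_mem_cells
    h.2⟩

theorem FinComplex.mem_body {K : FinComplex V} {x : V → ℝ} :
    x ∈ K.body ↔ (∀ v, 0 ≤ x v) ∧ ∑ v, x v = 1 ∧ ∃ σ ∈ K.faces, ∀ v ∉ σ, x v = 0 := by
  constructor
  · rintro ⟨_, ⟨σ, hσ, rfl⟩, hx⟩
    obtain ⟨h0, h1, h⟩ := mem_simplexOf.1 hx
    exact ⟨h0, h1, σ, hσ, h⟩
  · rintro ⟨h0, h1, σ, hσ, h⟩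
    exact ⟨_, ⟨σ, hσ, rfl⟩, mem_simplexOf.2 ⟨h0, h1, h⟩⟩

theorem plOn_realize (f : V → W) (D : Set (V → ℝ)) : PLOn (realize f) D :=
  PLOn.pi fun _ => PLOn.sum (f := fun v (x : V → ℝ) => x v) _ fun v _ => plOn_apply v D

theorem realize_nonneg {f : V → W} {x : V → ℝ} (hx : ∀ v, 0 ≤ x v) (w : W) :
    0 ≤ realize f x w :=
  Finset.sum_nonneg fun v _ => hx v

theorem sum_realize (f : V → W) (x : V → ℝ) : ∑ w, realize f x w = ∑ v, x v :=
  Finset.sum_fiberwise _ _ _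

theorem realize_eq_zero {f : V → W} {x : V → ℝ} {σ : Finset V} (hx : ∀ v ∉ σ, x v = 0) {w : W}
    (hw : w ∉ σ.image f) : realize f x w = 0 := by
  refine Finset.sum_eq_zero fun v hv => hx v fun hvσ => hw ?_
  exact Finset.mem_image.2 ⟨v, hvσ, (Finset.mem_filter.1 hv).2⟩

theorem realize_realize (g : W → T) (f : V → W) (x : V → ℝ) :
    realize g (realize f x) = realize (g ∘ f) x := by
  ext t
  simp only [realize, Finset.sum_filter, Function.comp_apply]
  calc _ = ∑ w, ∑ v, if f v = w then (if g w = t then x v else 0) else 0 := by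
        refine Finset.sum_congr rfl fun w _ => ?_
        split_ifs <;> simp
    _ = _ := by
        rw [Finset.sum_comm]
        simp

theorem realize_id (x : V → ℝ) : realize id x = x := by
  ext v
  simp [realize, Finset.sum_filter]

theorem realize_zero (f : V → W) : realize f 0 = 0 := by
  ext w
  simp [realize]

theorem realize_apply_of_injective {f : V → W} (hf : Function.Injective f) (x : V → ℝ) (v : V) :
    realize f x (f v) = x v := by
  simp [realize, hf.eq_iff, Finset.sum_filter]

theorem realize_comp_of_injective {f : V → W} (hf : Function.Injective f) {y : W → ℝ}
    (hy : ∀ w ∉ Set.range f, y w = 0) : realize f (y ∘ f) = y := by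
  ext w
  by_cases hw : w ∈ Set.range f
  · obtain ⟨v, rfl⟩ := hw
    rw [realize_apply_of_injective hf, Function.comp_apply]
  · rw [hy w hw]
    exact Finset.sum_eq_zero fun v hv => absurd ⟨v, (Finset.mem_filter.1 hv).2⟩ hw

theorem sum_comp_of_injective {f : V → W} (hf : Function.Injective f) {y : W → ℝ}
    (hy : ∀ w ∉ Set.range f, y w = 0) : ∑ v, y (f v) = ∑ w, y w := by
  rw [← realize_comp_of_injective hf hy, sum_realize]
  exact Finset.sum_congr rfl fun v _ => by rw [realize_apply_of_injective hf, Function.comp_apply]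

theorem IsSimplicialMap.mapsTo_realize {K : FinComplex V} {L : FinComplex W} {f : V → W}
    (hf : IsSimplicialMap K L f) : Set.MapsTo (realize f) K.body L.body := by
  intro x hx
  obtain ⟨h0, h1, σ, hσ, h⟩ := FinComplex.mem_body.1 hx
  exact FinComplex.mem_body.2 ⟨realize_nonneg h0, by rw [sum_realize, h1], _, hf σ hσ,
    fun w hw => realize_eq_zero h hw⟩

theorem isSimplicialMap_image (K : FinComplex V) (f : V → W) : IsSimplicialMap K (K.image f) f :=
  fun _ hσ => Finset.mem_image_of_mem _ hσ

theorem plOn_comp_right (f : V → W) (D : Set (W → ℝ)) : PLOn (fun y : W → ℝ => y ∘ f) D :=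
  PLOn.pi fun v => plOn_apply (f v) D

/-- The points of the body of a copy of `K` are, in coordinates, points of the body of `K`. -/
theorem comp_mem_body {K : FinComplex V} {f : V → W} (hf : Function.Injective f) {y : W → ℝ}
    (hy : y ∈ (K.image f).body) : y ∘ f ∈ K.body ∧ realize f (y ∘ f) = y := by
  obtain ⟨h0, h1, τ, hτ, h⟩ := FinComplex.mem_body.1 hy
  obtain ⟨σ, hσ, rfl⟩ := Finset.mem_image.1 hτ
  have hr : ∀ w ∉ Set.range f, y w = 0 := fun w hw => h w fun hw' => by
    obtain ⟨v, -, rfl⟩ := Finset.mem_image.1 hw'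
    exact hw ⟨v, rfl⟩
  refine ⟨FinComplex.mem_body.2 ⟨fun v => h0 _, ?_, σ, hσ, fun v hv => h _ ?_⟩,
    realize_comp_of_injective hf hr⟩
  · exact (sum_comp_of_injective hf hr).trans h1
  · simpa [hf.eq_iff] using hv

end Bodies

/-! ### Piecewise linear homotopies -/

section Homotopy

set_option linter.unusedSectionVars false

variable {V W U : Type*} [Fintype V] [DecidableEq V] [Fintype W] [DecidableEq W]
  [Fintype U] [DecidableEq U]

/-- A piecewise linear family of vectors `p x t` which grows from `0` to the point `x` of the
standard simplex, one coordinate after the other: the partial sums of `p x t` are the minima of `t`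
and the partial sums of `x`. The naive `t • x` is not piecewise linear in `(x, t)`. -/
theorem exists_plOn_transfer (V : Type*) [Fintype V] : ∃ p : (V → ℝ) × ℝ → V → ℝ,
    PLOn p Set.univ ∧ ∀ x : V → ℝ, (∀ v, 0 ≤ x v) → ∑ v, x v = 1 →
      (∀ t, 0 ≤ t → ∀ v, 0 ≤ p (x, t) v ∧ p (x, t) v ≤ x v) ∧ p (x, 0) = 0 ∧ p (x, 1) = x := by
  classical
  suffices ∀ S : Finset V, ∃ p : (V → ℝ) × ℝ → V → ℝ,
      PLOn p Set.univ ∧ ∀ x : V → ℝ, (∀ v, 0 ≤ x v) → ∀ t, 0 ≤ t →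
        (∀ v, 0 ≤ p (x, t) v ∧ p (x, t) v ≤ x v) ∧ (∀ v ∉ S, p (x, t) v = 0) ∧
          ∑ v, p (x, t) v = min (∑ v ∈ S, x v) t by
    obtain ⟨p, hp, h⟩ := this Finset.univ
    refine ⟨p, hp, fun x hx hx1 => ⟨fun t ht => (h x hx t ht).1, ?_, ?_⟩⟩
    · obtain ⟨h1, -, h2⟩ := h x hx 0 le_rfl
      rw [hx1, min_eq_right zero_le_one] at h2
      funext v
      exact (Finset.sum_eq_zero_iff_of_nonneg fun v _ => (h1 v).1).1 h2 v (Finset.mem_univ v)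
    · obtain ⟨h1, -, h2⟩ := h x hx 1 zero_le_one
      rw [hx1, min_self] at h2
      funext v
      exact (Finset.sum_eq_sum_iff_of_le fun v _ => (h1 v).2).1 (h2.trans hx1.symm) v (Finset.mem_univ v)
  intro S
  induction S using Finset.induction_on with
  | empty =>
    refine ⟨fun _ => 0, plOn_const _ _, fun x hx t ht => ⟨fun v => ⟨le_rfl, hx v⟩, ?_, ?_⟩⟩
    · simp
    · simp [ht]
  | insert a S ha ih =>
    obtain ⟨p, hp, h⟩ := ih
    have hfst : PLOn (fun q : (V → ℝ) × ℝ => q.1) Set.univ :=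
      (LinearMap.fst ℝ (V → ℝ) ℝ).plOn _
    have hsnd : PLOn (fun q : (V → ℝ) × ℝ => q.2) Set.univ :=
      (LinearMap.snd ℝ (V → ℝ) ℝ).plOn _
    have hsum : ∀ S : Finset V, PLOn (fun q : (V → ℝ) × ℝ => ∑ v ∈ S, q.1 v) Set.univ :=
      fun S => PLOn.sum S fun v _ => (plOn_apply v Set.univ).comp hfst (Set.mapsTo_univ _ _)
    let e : (V → ℝ) × ℝ → ℝ := fun q =>
      min (∑ v ∈ insert a S, q.1 v) q.2 - min (∑ v ∈ S, q.1 v) q.2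
    have he : PLOn e Set.univ := ((hsum _).min hsnd).sub ((hsum _).min hsnd)
    have hsingle : PLOn (fun q => (Pi.single a (e q) : V → ℝ)) Set.univ :=
      (LinearMap.single ℝ (fun _ : V => ℝ) a).comp_plOn he
    refine ⟨fun q => p q + Pi.single a (e q), hp.add hsingle, fun x hx t ht => ?_⟩
    obtain ⟨h1, h2, h3⟩ := h x hx t ht
    have he0 : 0 ≤ e (x, t) ∧ e (x, t) ≤ x a := by
      simp only [e, Finset.sum_insert ha]
      have := hx a
      constructor
      · refine sub_nonneg.2 (min_le_min_right _ (by linarith))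
      · rw [sub_le_iff_le_add, min_def, min_def]
        split_ifs <;> linarith
    refine ⟨fun v => ?_, fun v hv => ?_, ?_⟩
    · by_cases hva : v = a
      · subst hva
        simpa [h2 v ha] using he0
      · simpa [hva] using h1 v
    · rw [Finset.mem_insert, not_or] at hv
      simp [hv.1, h2 v hv.2]
    · simp [Finset.sum_add_distrib, h3, e]

/-- Contiguous simplicial maps are homotopic. -/
theorem exists_plOn_homotopy_of_contiguous {K : FinComplex V} {L : FinComplex W} {f g : V → W}
    (h : ∀ σ ∈ K.faces, σ.image f ∪ σ.image g ∈ L.faces) :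
    ∃ H : (V → ℝ) × ℝ → (W → ℝ), PLOn H (K.body ×ˢ Set.Icc 0 1) ∧
      Set.MapsTo H (K.body ×ˢ Set.Icc 0 1) L.body ∧
      ∀ x ∈ K.body, H (x, 0) = realize f x ∧ H (x, 1) = realize g x := by
  obtain ⟨p, hp, hp'⟩ := exists_plOn_transfer V
  have hq : PLOn (fun q : (V → ℝ) × ℝ => q.1 - p q) Set.univ :=
    PLOn.sub ((LinearMap.fst ℝ (V → ℝ) ℝ).plOn _) hp
  have hfg : PLOn (fun q => realize g (p q) + realize f (q.1 - p q)) Set.univ :=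
    ((plOn_realize g Set.univ).comp hp (Set.mapsTo_univ _ _)).add
      ((plOn_realize f Set.univ).comp hq (Set.mapsTo_univ _ _))
  refine ⟨_, hfg.mono (Set.subset_univ _), ?_, fun x hx => ?_⟩
  · rintro ⟨x, t⟩ ⟨hx, ht⟩
    obtain ⟨h0, h1, σ, hσ, hxσ⟩ := FinComplex.mem_body.1 hx
    have hpt := (hp' x h0 h1).1 t ht.1
    refine FinComplex.mem_body.2 ⟨fun w => add_nonneg (realize_nonneg (fun v => (hpt v).1) w)
      (realize_nonneg (fun v => sub_nonneg.2 (hpt v).2) w), ?_, _, h σ hσ, fun w hw => ?_⟩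
    · simp [Finset.sum_add_distrib, sum_realize, h1]
    · rw [Finset.mem_union, not_or] at hw
      have hpσ : ∀ v ∉ σ, p (x, t) v = 0 := fun v hv =>
        le_antisymm ((hpt v).2.trans (hxσ v hv).le) (hpt v).1
      have hpσ' : ∀ v ∉ σ, (x - p (x, t)) v = 0 := fun v hv => by
        rw [Pi.sub_apply, hpσ v hv, sub_zero]
        exact hxσ v hv
      simp [realize_eq_zero hpσ hw.2, realize_eq_zero hpσ' hw.1]
  · obtain ⟨h0, h1, -⟩ := FinComplex.mem_body.1 hx
    obtain ⟨-, e0, e1⟩ := hp' x h0 h1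
    simp [e0, e1, realize_zero]

/-- Given levels `a ≤ b`, there is a piecewise linear way to distribute the mass `b - a` over the
coordinates of `z` that are larger than `a`, provided that some coordinate is at least `b`: the
coordinates are run through in some order, and each gets the increment of the running maximum,
clipped to `[a, b]`. -/
theorem exists_plOn_distribution {D : Set (U → ℝ)} {a b : (U → ℝ) → ℝ} (ha : PLOn a D)
    (hb : PLOn b D) (hab : ∀ z ∈ D, a z ≤ b z) : ∃ η : (U → ℝ) → U → ℝ, PLOn η D ∧
      ∀ z ∈ D, (∀ v, 0 ≤ η z v) ∧ (∀ v, z v ≤ a z → η z v = 0) ∧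
        ((∃ v, b z ≤ z v) → ∑ v, η z v = b z - a z) := by
  suffices ∀ S : Finset U, ∃ (m : (U → ℝ) → ℝ) (η : (U → ℝ) → U → ℝ), PLOn m D ∧ PLOn η D ∧
      ∀ z ∈ D, (∀ v, 0 ≤ η z v) ∧ (∀ v, z v ≤ a z → η z v = 0) ∧
        (∀ v ∈ S, z v ≤ m z) ∧ a z ≤ m z ∧ ∑ v, η z v = min (m z) (b z) - a z by
    obtain ⟨m, η, -, hη, h⟩ := this Finset.univ
    refine ⟨η, hη, fun z hz => ?_⟩
    obtain ⟨h1, h2, h3, -, h4⟩ := h z hz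
    refine ⟨h1, h2, fun ⟨v, hv⟩ => ?_⟩
    rw [h4, min_eq_right (hv.trans (h3 v (Finset.mem_univ v)))]
  intro S
  induction S using Finset.induction_on with
  | empty =>
    refine ⟨a, fun _ => 0, ha, plOn_const _ _, fun z hz => ?_⟩
    simp [hab z hz]
  | insert u S hu ih =>
    obtain ⟨m, η, hm, hη, h⟩ := ih
    let m' : (U → ℝ) → ℝ := fun z => max (m z) (z u)
    have hm' : PLOn m' D := hm.max (plOn_apply u D)
    let e : (U → ℝ) → ℝ := fun z => min (m' z) (b z) - min (m z) (b z)
    have he : PLOn e D := (hm'.min hb).sub (hm.min hb)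
    have hsingle : PLOn (fun z => (Pi.single u (e z) : U → ℝ)) D :=
      (LinearMap.single ℝ (fun _ : U => ℝ) u).comp_plOn he
    refine ⟨m', fun z => η z + Pi.single u (e z), hm', hη.add hsingle, fun z hz => ?_⟩
    obtain ⟨h1, h2, h3, h4, h5⟩ := h z hz
    have he0 : 0 ≤ e z := sub_nonneg.2 (min_le_min_right _ (le_max_left _ _))
    refine ⟨fun v => ?_, fun v hv => ?_, fun v hv => ?_, h4.trans (le_max_left _ _), ?_⟩
    · refine add_nonneg (h1 v) ?_
      by_cases hvu : v = u
      · subst hvu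
        simpa using he0
      · simp [hvu]
    · by_cases hvu : v = u
      · subst hvu
        have : m' z = m z := max_eq_left (hv.trans h4)
        simp [h2 v hv, e, this]
      · simp [h2 v hv, hvu]
    · rcases Finset.mem_insert.1 hv with rfl | hv
      · exact le_max_right _ _
      · exact (h3 v hv).trans (le_max_left _ _)
    · simp [Finset.sum_add_distrib, h5, e]

/-- The smallest of the coordinates in a nonempty set `τ` is a piecewise linear function. -/
theorem exists_plOn_min {τ : Finset U} (hτ : τ.Nonempty) : ∃ μ : (U → ℝ) → ℝ,
    PLOn μ Set.univ ∧ ∀ z, (∀ v ∈ τ, μ z ≤ z v) ∧ ∃ v ∈ τ, μ z = z v := by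
  refine ⟨fun z => τ.inf' hτ z, ?_, fun z => ⟨fun v hv => Finset.inf'_le _ hv, ?_⟩⟩
  · induction hτ using Finset.Nonempty.cons_induction with
    | singleton v => simpa using plOn_apply v Set.univ
    | cons v s hv hs ih =>
      simp only [Finset.inf'_cons hs]
      exact (plOn_apply v Set.univ).min ih
  · obtain ⟨v, hv, h⟩ := Finset.exists_mem_eq_inf' hτ z
    exact ⟨v, hv, h⟩

/-- A piecewise linear function that measures the distance to the body of a subcomplex `K`: it
vanishes on the body, and the coordinates which exceed it always span a face of `K`. -/
theorem exists_plOn_level (K : FinComplex U) : ∃ θ : (U → ℝ) → ℝ, PLOn θ Set.univ ∧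
    ∀ z : U → ℝ, (∀ v, 0 ≤ z v) → 0 ≤ θ z ∧ (∃ σ ∈ K.faces, ∀ v, θ z < z v → v ∈ σ) ∧
      (z ∈ K.body → θ z = 0) := by
  let 𝒯 : Finset (Finset U) := Finset.univ.filter fun τ => τ ∉ K.faces
  have h𝒯 : ∀ τ ∈ 𝒯, τ ∉ K.faces := fun τ hτ => (Finset.mem_filter.1 hτ).2
  have hne : ∀ τ ∈ 𝒯, τ.Nonempty := fun τ hτ => by
    rw [Finset.nonempty_iff_ne_empty]
    rintro rfl
    exact h𝒯 _ hτ K.empty_mem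
  choose! μ hμ hμ' using fun τ hτ => exists_plOn_min (hne τ hτ)
  have hμ0 : ∀ z : U → ℝ, (∀ v, 0 ≤ z v) → ∀ τ ∈ 𝒯, 0 ≤ μ τ z := by
    intro z hz τ hτ
    obtain ⟨v, -, h⟩ := (hμ' τ hτ z).2
    rw [h]
    exact hz v
  refine ⟨fun z => ∑ τ ∈ 𝒯, μ τ z, PLOn.sum _ hμ, fun z hz => ⟨?_, ?_, fun hzK => ?_⟩⟩
  · exact Finset.sum_nonneg (hμ0 z hz)
  · let σ : Finset U := Finset.univ.filter fun v => ∑ τ ∈ 𝒯, μ τ z < z v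
    refine ⟨σ, ?_, by simp [σ]⟩
    by_contra hσ
    have hσ' : σ ∈ 𝒯 := Finset.mem_filter.2 ⟨Finset.mem_univ _, hσ⟩
    obtain ⟨v, hv, h⟩ := (hμ' _ hσ' z).2
    have hv := (Finset.mem_filter.1 hv).2
    rw [← h] at hv
    exact absurd (Finset.single_le_sum (hμ0 z hz) hσ') (not_le.2 hv)
  · obtain ⟨-, -, σ, hσ, hzσ⟩ := FinComplex.mem_body.1 hzK
    refine Finset.sum_eq_zero fun τ hτ => ?_
    obtain ⟨v, hv, hvσ⟩ := Finset.not_subset.1 fun h => h𝒯 τ hτ (K.down_closed σ hσ τ h)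
    exact le_antisymm (((hμ' τ hτ z).1 v hv).trans (hzσ v hvσ).le) (hμ0 z hz τ hτ)

/-- A piecewise linear self-map of the body of `X` which is the identity on the body of a
subcomplex `K` and pushes a neighbourhood of it into it. The coordinates are lowered by a small
level, so that only a face of `K` survives, and the mass lost is given to the surviving
coordinates. -/
theorem exists_plOn_push (X K : FinComplex U) : ∃ (θ : (U → ℝ) → ℝ) (ρ : (U → ℝ) → (U → ℝ))
    (ε : ℝ), 0 < ε ∧ PLOn θ X.body ∧ PLOn ρ X.body ∧ Set.MapsTo ρ X.body X.body ∧
      (∀ z ∈ X.body, 0 ≤ θ z) ∧ (∀ z ∈ X.body, θ z ≤ ε → ρ z ∈ K.body) ∧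
      ∀ z ∈ X.body, z ∈ K.body → θ z = 0 ∧ ρ z = z := by
  obtain ⟨θ, hθ, hθ'⟩ := exists_plOn_level K
  let N : ℝ := Fintype.card U
  have hN : 0 < N + 1 := by positivity
  let ε : ℝ := (N + 1)⁻¹ * (N + 1)⁻¹
  have hε : 0 < ε := by positivity
  let s : (U → ℝ) → ℝ := fun z => min (θ z) ε
  let b : (U → ℝ) → ℝ := fun z => s z + ∑ w, min (z w) (s z)
  have hθX : PLOn θ X.body := hθ.mono (Set.subset_univ _)
  have hs : PLOn s X.body := hθX.min (plOn_const _ _)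
  have hb : PLOn b X.body := hs.add (PLOn.sum _ fun w _ => (plOn_apply w _).min hs)
  have hX0 : ∀ z ∈ X.body, ∀ v, 0 ≤ z v := fun z hz => (FinComplex.mem_body.1 hz).1
  have hs0 : ∀ z ∈ X.body, 0 ≤ s z := fun z hz => le_min (hθ' z (hX0 z hz)).1 hε.le
  have hsb : ∀ z ∈ X.body, s z ≤ b z := fun z hz => le_add_of_nonneg_right
    (Finset.sum_nonneg fun w _ => le_min (hX0 z hz w) (hs0 z hz))
  -- `ε` is so small that the largest coordinate of a point of the body exceeds `b`
  have hmax : ∀ z ∈ X.body, ∃ v, b z ≤ z v := by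
    intro z hz
    obtain ⟨-, h1, -⟩ := FinComplex.mem_body.1 hz
    have hne : (Finset.univ : Finset U).Nonempty := by
      by_contra h
      rw [Finset.not_nonempty_iff_eq_empty] at h
      simp [h] at h1
    obtain ⟨v, -, hv⟩ := Finset.exists_le_of_sum_le (f := fun _ => (N + 1)⁻¹) (g := z) hne (by
      simp only [Finset.sum_const, Finset.card_univ, nsmul_eq_mul, h1]
      rw [← div_eq_mul_inv, div_le_one hN]
      linarith)
    refine ⟨v, le_trans ?_ hv⟩
    calc b z ≤ ε + ∑ _w : U, ε := add_le_add (min_le_right _ _)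
          (Finset.sum_le_sum fun w _ => (min_le_right _ _).trans (min_le_right _ _))
      _ = (N + 1) * ε := by
          simp only [Finset.sum_const, Finset.card_univ, nsmul_eq_mul, N]
          ring
      _ = (N + 1)⁻¹ := mul_inv_cancel_left₀ hN.ne' _
  obtain ⟨η, hη, hη'⟩ := exists_plOn_distribution hs hb hsb
  let ρ : (U → ℝ) → (U → ℝ) := fun z v => max (z v - s z) 0 + η z v
  have hρ : PLOn ρ X.body := PLOn.pi fun v =>
    (((plOn_apply v _).sub hs).max (plOn_const _ _)).add ((plOn_apply v Set.univ).comp hη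
      (Set.mapsTo_univ _ _))
  have hρ0 : ∀ z ∈ X.body, ∀ v, 0 ≤ ρ z v := fun z hz v =>
    add_nonneg (le_max_right _ _) ((hη' z hz).1 v)
  have hρs : ∀ z ∈ X.body, ∀ v, z v ≤ s z → ρ z v = 0 := fun z hz v hv => by
    simp only [ρ, (hη' z hz).2.1 v hv, add_zero]
    exact max_eq_right (by linarith)
  have hρ1 : ∀ z ∈ X.body, ∑ v, ρ z v = 1 := by
    intro z hz
    rw [← (FinComplex.mem_body.1 hz).2.1]
    simp only [ρ, Finset.sum_add_distrib, (hη' z hz).2.2 (hmax z hz), b, add_sub_cancel_left]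
    rw [← Finset.sum_add_distrib]
    refine Finset.sum_congr rfl fun v _ => ?_
    rcases le_total (z v) (s z) with h | h
    · rw [min_eq_left h, max_eq_right (by linarith), zero_add]
    · rw [min_eq_right h, max_eq_left (by linarith), sub_add_cancel]
  refine ⟨θ, ρ, ε, hε, hθX, hρ, fun z hz => ?_, fun z hz => (hθ' z (hX0 z hz)).1,
    fun z hz hzε => ?_, fun z hz hzK => ?_⟩
  · obtain ⟨-, -, σ, hσ, hzσ⟩ := FinComplex.mem_body.1 hz
    exact FinComplex.mem_body.2 ⟨hρ0 z hz, hρ1 z hz, σ, hσ, fun v hv =>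
      hρs z hz v ((hzσ v hv).le.trans (hs0 z hz))⟩
  · obtain ⟨-, ⟨σ, hσ, hzσ⟩, -⟩ := hθ' z (hX0 z hz)
    refine FinComplex.mem_body.2 ⟨hρ0 z hz, hρ1 z hz, σ, hσ, fun v hv => hρs z hz v ?_⟩
    simp only [s, min_eq_left hzε]
    exact not_lt.1 fun h => hv (hzσ v h)
  · have h0 := (hθ' z (hX0 z hz)).2.2 hzK
    have hs0 : s z = 0 := by simp [s, h0, hε.le]
    refine ⟨h0, funext fun v => ?_⟩
    have hsum : ∑ v, η z v = 0 := by
      rw [(hη' z hz).2.2 (hmax z hz)]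
      simp only [b, hs0, zero_add, sub_zero]
      exact Finset.sum_eq_zero fun w _ => min_eq_right (hX0 z hz w)
    have hη0 := (Finset.sum_eq_zero_iff_of_nonneg fun v _ => (hη' z hz).1 v).1 hsum v
      (Finset.mem_univ v)
    simp [ρ, hs0, hη0, hX0 z hz v]

/-- The homotopy extension property of the pair formed by a complex `X` and a copy of `P` in it:
if a map extends to `X`, then so does a homotopic one. -/
theorem exists_extension_of_homotopy {P : FinComplex V} {X : FinComplex U} {Y : FinComplex W}
    {i : V → U} (hi : IsSubcomplexEmbedding P X i) {F : (U → ℝ) → (W → ℝ)} (hF : PLOn F X.body)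
    (hFY : Set.MapsTo F X.body Y.body) {H : (V → ℝ) × ℝ → (W → ℝ)}
    (hH : PLOn H (P.body ×ˢ Set.Icc 0 1)) (hHY : Set.MapsTo H (P.body ×ˢ Set.Icc 0 1) Y.body)
    (hHF : ∀ x ∈ P.body, H (x, 0) = F (realize i x)) :
    ExtendsPL P X Y i fun x => H (x, 1) := by
  classical
  obtain ⟨θ, ρ, ε, hε, hθ, hρ, hρX, hθ0, hρK, hK⟩ := exists_plOn_push X (P.image i)
  have hpull : ∀ z ∈ X.body, θ z ≤ ε → ρ z ∘ i ∈ P.body ∧ realize i (ρ z ∘ i) = ρ z :=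
    fun z hz hzε => comp_mem_body hi.1 (hρK z hz hzε)
  let G : (U → ℝ) → (W → ℝ) := fun z =>
    if θ z ≤ ε then H (ρ z ∘ i, 1 - ε⁻¹ * θ z) else F (ρ z)
  have htime : ∀ z ∈ X.body, θ z ≤ ε → 1 - ε⁻¹ * θ z ∈ Set.Icc (0 : ℝ) 1 := by
    intro z hz hzε
    constructor
    · rw [sub_nonneg, inv_mul_le_iff₀ hε, mul_one]
      exact hzε
    · have := mul_nonneg (inv_nonneg.2 hε.le) (hθ0 z hz)
      linarith
  have hnear : PLOn G {z ∈ X.body | θ z ≤ ε} := by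
    have h1 : PLOn (fun z => (ρ z ∘ i, 1 - ε⁻¹ * θ z)) X.body :=
      ((plOn_comp_right i Set.univ).comp hρ (Set.mapsTo_univ _ _)).prodMk
        ((plOn_const 1 _).sub (hθ.const_mul ε⁻¹))
    refine (hH.comp (h1.mono fun z hz => hz.1) fun z hz => ?_).congr fun z hz => if_pos hz.2
    exact ⟨(hpull z hz.1 hz.2).1, htime z hz.1 hz.2⟩
  have hfar : PLOn G {z ∈ X.body | ε ≤ θ z} := by
    refine (hF.comp (hρ.mono fun z hz => hz.1) fun z hz => hρX hz.1).congr fun z hz => ?_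
    by_cases h : θ z ≤ ε
    · have heq : θ z = ε := le_antisymm h hz.2
      have : 1 - ε⁻¹ * θ z = 0 := by
        rw [heq, inv_mul_cancel₀ hε.ne', sub_self]
      obtain ⟨h1, h2⟩ := hpull z hz.1 h
      simp only [G, if_pos h, this]
      rw [hHF _ h1, h2]
    · exact if_neg h
  have hcover : X.body = {z ∈ X.body | θ z ≤ ε} ∪ {z ∈ X.body | ε ≤ θ z} := by
    ext z
    have := le_total (θ z) ε
    simp only [Set.mem_union, Set.mem_ofPred_eq]
    tauto
  refine ⟨G, isPLMap_iff.2 ⟨?_, fun z hz => ?_⟩, fun x hx => ?_⟩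
  · rw [hcover]
    exact hnear.union hfar
      (X.isClosed_body.isClosed_le hθ.continuousOn continuousOn_const)
      (X.isClosed_body.isClosed_le continuousOn_const hθ.continuousOn)
      (hθ.isSemilinear_le (plOn_const _ _) X.isSemilinear_body)
      ((plOn_const _ _).isSemilinear_le hθ X.isSemilinear_body)
  · by_cases h : θ z ≤ ε
    · simp only [G, if_pos h]
      exact hHY ⟨(hpull z hz h).1, htime z hz h⟩
    · simp only [G, if_neg h]
      exact hFY (hρX hz)
  · have hxX := hi.2.mapsTo_realize hx
    obtain ⟨h0, hρx⟩ := hK _ hxX ((isSimplicialMap_image P i).mapsTo_realize hx)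
    have hcomp : realize i x ∘ i = x := funext fun v => realize_apply_of_injective hi.1 x v
    simp [G, h0, hε.le, hρx, hcomp]

end Homotopy

/-! ### Mapping cylinders -/

section Cylinder

set_option linter.unusedSectionVars false

variable {V W T : Type*} [Fintype V] [DecidableEq V] [Fintype W] [DecidableEq W]
  [Fintype T] [DecidableEq T]

/-- The simplicial mapping cylinder of `g : P → Q`: it contains `Q` and, for each face `ρ` of `P`,
the simplex spanned by the copies of `ρ` and of `g(ρ)`, with all its faces. -/
def mappingCylinder (P : FinComplex V) (Q : FinComplex W) (g : V → W) (iP : V → T) (iQ : W → T) :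
    FinComplex T where
  faces := (P.faces.biUnion fun ρ => (ρ.image iP ∪ ρ.image (iQ ∘ g)).powerset) ∪
    Q.faces.image fun σ => σ.image iQ
  empty_mem := Finset.mem_union_right _ (Finset.mem_image.2 ⟨∅, Q.empty_mem, rfl⟩)
  down_closed := by
    intro τ hτ τ' hτ'
    rcases Finset.mem_union.1 hτ with h | h
    · obtain ⟨ρ, hρ, h⟩ := Finset.mem_biUnion.1 h
      exact Finset.mem_union_left _ (Finset.mem_biUnion.2 ⟨ρ, hρ,
        Finset.mem_powerset.2 (hτ'.trans (Finset.mem_powerset.1 h))⟩)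
    · exact Finset.mem_union_right _ ((Q.image iQ).down_closed τ h τ' hτ')

theorem mem_faces_mappingCylinder {P : FinComplex V} {Q : FinComplex W} {g : V → W} {iP : V → T}
    {iQ : W → T} {τ : Finset T} : τ ∈ (mappingCylinder P Q g iP iQ).faces ↔
      (∃ ρ ∈ P.faces, τ ⊆ ρ.image iP ∪ ρ.image (iQ ∘ g)) ∨
        ∃ σ ∈ Q.faces, σ.image iQ = τ := by
  simp only [mappingCylinder, Finset.mem_union, Finset.mem_biUnion, Finset.mem_powerset,
    Finset.mem_image]

/-- The properties of a complex `C` with copies of `P` and `Q` that make it a mapping cylinder of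
`g : P → Q`: there is a simplicial retraction `r` onto `Q` that restricts to `g` on `P`, and each
face of `P` spans a face together with its image in `Q`. -/
structure IsMappingCylinder (P : FinComplex V) (Q : FinComplex W) (g : V → W) (C : FinComplex T)
    (iP : V → T) (iQ : W → T) (r : T → W) : Prop where
  embP : IsSubcomplexEmbedding P C iP
  embQ : IsSubcomplexEmbedding Q C iQ
  full : ∀ σ : Finset V, σ.image iP ∈ C.faces → σ ∈ P.faces
  retr : IsSimplicialMap C Q r
  retr_comp_iP : r ∘ iP = g
  retr_comp_iQ : r ∘ iQ = id
  join : ∀ σ ∈ P.faces, σ.image iP ∪ σ.image (iQ ∘ g) ∈ C.faces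

theorem isMappingCylinder_mappingCylinder {P : FinComplex V} {Q : FinComplex W} {g : V → W}
    (hg : IsSimplicialMap P Q g) {iP : V → T} {iQ : W → T} {r : T → W}
    (hiP : Function.Injective iP) (hPQ : ∀ v w, iP v ≠ iQ w) (hrP : r ∘ iP = g)
    (hrQ : r ∘ iQ = id) :
    IsMappingCylinder P Q g (mappingCylinder P Q g iP iQ) iP iQ r := by
  have hiQ : Function.Injective iQ := Function.LeftInverse.injective (g := r) (congrFun hrQ)
  refine ⟨⟨hiP, fun σ hσ => ?_⟩, ⟨hiQ, fun σ hσ => ?_⟩, fun σ hσ => ?_, fun τ hτ => ?_, hrP, hrQ,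
    fun σ hσ => ?_⟩
  · exact mem_faces_mappingCylinder.2 (Or.inl ⟨σ, hσ, Finset.subset_union_left⟩)
  · exact mem_faces_mappingCylinder.2 (Or.inr ⟨σ, hσ, rfl⟩)
  · rcases mem_faces_mappingCylinder.1 hσ with ⟨ρ, hρ, h⟩ | ⟨ρ, hρ, h⟩
    · refine P.down_closed ρ hρ σ fun v hv => ?_
      rcases Finset.mem_union.1 (h (Finset.mem_image_of_mem iP hv)) with h | h
      · obtain ⟨u, hu, huv⟩ := Finset.mem_image.1 h
        rwa [← hiP huv]
      · obtain ⟨u, -, huv⟩ := Finset.mem_image.1 h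
        exact absurd huv.symm (hPQ v _)
    · have : σ = ∅ := Finset.eq_empty_of_forall_notMem fun v hv => by
        have := Finset.mem_image_of_mem iP hv
        rw [← h] at this
        obtain ⟨u, -, huv⟩ := Finset.mem_image.1 this
        exact hPQ v u huv.symm
      rw [this]
      exact P.empty_mem
  · rcases mem_faces_mappingCylinder.1 hτ with ⟨ρ, hρ, h⟩ | ⟨ρ, hρ, rfl⟩
    · refine Q.down_closed _ (hg ρ hρ) _ ((Finset.image_subset_image h).trans ?_)
      rw [Finset.image_union, Finset.image_image, Finset.image_image, ← Function.comp_assoc,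
        hrP, hrQ, Function.id_comp, Finset.union_self]
    · rwa [Finset.image_image, hrQ, Finset.image_id]
  · exact mem_faces_mappingCylinder.2 (Or.inl ⟨σ, hσ, subset_rfl⟩)

namespace IsMappingCylinder

variable {P : FinComplex V} {Q : FinComplex W} {g : V → W} {C : FinComplex T} {iP : V → T}
  {iQ : W → T} {r : T → W}

/-- A map of `P` extends to a mapping cylinder of `g` if and only if it factors up to homotopy
through `g`. -/
theorem extendsPL_iff (hC : IsMappingCylinder P Q g C iP iQ r) {Z : Type*} [Fintype Z]
    [DecidableEq Z] {Y : FinComplex Z} {f : (V → ℝ) → (Z → ℝ)} :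
    ExtendsPL P C Y iP f ↔
      ∃ κ : (W → ℝ) → (Z → ℝ), IsPLMap Q Y κ ∧ PLHomotopic P Y (κ ∘ realize g) f := by
  constructor
  · rintro ⟨F, hF, hFf⟩
    obtain ⟨hF, hFY⟩ := isPLMap_iff.1 hF
    obtain ⟨h, hh, hhC, h01⟩ := exists_plOn_homotopy_of_contiguous (K := P) (L := C)
      (f := iQ ∘ g) (g := iP) fun σ hσ => by
        rw [Finset.union_comm]
        exact hC.join σ hσ
    refine ⟨fun y => F (realize iQ y), isPLMap_iff.2
      ⟨hF.comp (plOn_realize iQ _) hC.embQ.2.mapsTo_realize,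
        fun y hy => hFY (hC.embQ.2.mapsTo_realize hy)⟩, plHomotopic_iff.2
      ⟨fun q => F (h q), hF.comp hh hhC, fun q hq => hFY (hhC hq), fun x hx => ⟨?_, ?_⟩⟩⟩
    · simp only [(h01 x hx).1, Function.comp_apply, realize_realize]
    · simp only [(h01 x hx).2, hFf x hx]
  · rintro ⟨κ, hκ, hκf⟩
    obtain ⟨hκ, hκY⟩ := isPLMap_iff.1 hκ
    obtain ⟨H, hH, hHY, h01⟩ := plHomotopic_iff.1 hκf
    obtain ⟨F, hF, hFf⟩ := exists_extension_of_homotopy hC.embP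
      (F := fun y => κ (realize r y)) (hκ.comp (plOn_realize r _) hC.retr.mapsTo_realize)
      (fun y hy => hκY (hC.retr.mapsTo_realize hy)) hH hHY fun x hx => by
        simp only [(h01 x hx).1, Function.comp_apply, realize_realize, hC.retr_comp_iP]
    exact ⟨F, hF, fun x hx => (hFf x hx).trans (h01 x hx).2⟩

end IsMappingCylinder

end Cylinder

/-! ### Gluing a mapping cylinder -/

section Gluing

set_option linter.unusedSectionVars false

variable {V W T U : Type*} [Fintype V] [DecidableEq V] [Fintype W] [DecidableEq W]
  [Fintype T] [DecidableEq T] [Fintype U] [DecidableEq U]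

theorem FinComplex.body_union (K L : FinComplex V) : (K.union L).body = K.body ∪ L.body := by
  ext x
  simp only [Set.mem_union, FinComplex.mem_body, FinComplex.union, Finset.mem_union]
  constructor
  · rintro ⟨h0, h1, σ, hσ | hσ, h⟩
    exacts [Or.inl ⟨h0, h1, σ, hσ, h⟩, Or.inr ⟨h0, h1, σ, hσ, h⟩]
  · rintro (⟨h0, h1, σ, hσ, h⟩ | ⟨h0, h1, σ, hσ, h⟩)
    exacts [⟨h0, h1, σ, Or.inl hσ, h⟩, ⟨h0, h1, σ, Or.inr hσ, h⟩]

theorem glueRight_apply {i : V → U} {j : V → T} (hj : Function.Injective j) (v : V) :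
    glueRight i j (j v) = Sum.inl (i v) := by
  have h : ∃ u, j u = j v := ⟨v, rfl⟩
  rw [glueRight, dif_pos h, hj h.choose_spec]

theorem glueRight_of_forall_ne {i : V → U} {j : V → T} {t : T} (ht : ∀ v, j v ≠ t) :
    glueRight i j t = Sum.inr ⟨t, ht⟩ :=
  dif_neg fun ⟨v, hv⟩ => ht v hv

theorem glueRight_injective {i : V → U} {j : V → T} (hi : Function.Injective i)
    (hj : Function.Injective j) : Function.Injective (glueRight i j) := by
  intro s t hst
  by_cases hs : ∃ v, j v = s <;> by_cases ht : ∃ v, j v = t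
  · obtain ⟨v, rfl⟩ := hs
    obtain ⟨w, rfl⟩ := ht
    rw [glueRight_apply hj, glueRight_apply hj, Sum.inl.injEq] at hst
    rw [hi hst]
  · obtain ⟨v, rfl⟩ := hs
    push Not at ht
    rw [glueRight_apply hj, glueRight_of_forall_ne ht] at hst
    cases hst
  · obtain ⟨v, rfl⟩ := ht
    push Not at hs
    rw [glueRight_apply hj, glueRight_of_forall_ne hs] at hst
    cases hst
  · push Not at hs ht
    rw [glueRight_of_forall_ne ht, glueRight_of_forall_ne hs, Sum.inr.injEq,
      Subtype.mk.injEq] at hst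
    exact hst

/-- The bodies of `X` and `C` meet only in the body of `P` inside the body of `X ∪_P C`. -/
theorem exists_of_mem_body_inter {P : FinComplex V} {X : FinComplex U} {C : FinComplex T}
    {i : V → U} {j : V → T} (hi : Function.Injective i) (hj : Function.Injective j)
    (hfull : ∀ σ : Finset V, σ.image j ∈ C.faces → σ ∈ P.faces) {z : GlueVertex U j → ℝ}
    (hzX : z ∈ (X.image (Sum.inl : U → GlueVertex U j)).body)
    (hzC : z ∈ (C.image (glueRight i j)).body) :
    ∃ x ∈ P.body, z ∘ Sum.inl = realize i x ∧ z ∘ glueRight i j = realize j x := by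
  obtain ⟨hyC, hyz⟩ := comp_mem_body (glueRight_injective hi hj) hzC
  set y := z ∘ glueRight i j with hy
  have hsupp : ∀ t ∉ Set.range j, y t = 0 := by
    intro t ht
    obtain ⟨-, -, τ, hτ, hzτ⟩ := FinComplex.mem_body.1 hzX
    obtain ⟨σ, -, rfl⟩ := Finset.mem_image.1 hτ
    refine hzτ _ fun hmem => ?_
    obtain ⟨u, -, hu⟩ := Finset.mem_image.1 hmem
    rw [glueRight_of_forall_ne fun v hv => ht ⟨v, hv⟩] at hu
    cases hu
  have hyx : realize j (y ∘ j) = y := realize_comp_of_injective hj hsupp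
  obtain ⟨h0, h1, τ, hτ, hyτ⟩ := FinComplex.mem_body.1 hyC
  refine ⟨y ∘ j, FinComplex.mem_body.2 ⟨fun v => h0 _, ?_,
    Finset.univ.filter fun v => j v ∈ τ, hfull _ (C.down_closed τ hτ _ ?_), fun v hv => ?_⟩,
    ?_, hyx.symm⟩
  · exact (sum_comp_of_injective hj hsupp).trans h1
  · intro t ht
    obtain ⟨v, hv, rfl⟩ := Finset.mem_image.1 ht
    exact (Finset.mem_filter.1 hv).2
  · exact hyτ _ fun h => hv (Finset.mem_filter.2 ⟨Finset.mem_univ v, h⟩)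
  · have hz : z = realize Sum.inl (realize i (y ∘ j)) := by
      rw [← hyz, ← hyx, realize_realize, realize_realize]
      have : glueRight i j ∘ j = Sum.inl ∘ i := funext fun v => glueRight_apply hj v
      rw [this, hyx]
    funext u
    rw [hz, Function.comp_apply, realize_apply_of_injective Sum.inl_injective]

theorem isSimplicialMap_inl_glue (X : FinComplex U) (C : FinComplex T) (i : V → U) (j : V → T) :
    IsSimplicialMap X (glue X C i j) Sum.inl := fun σ hσ =>
  Finset.mem_union_left _ (isSimplicialMap_image X _ σ hσ)

theorem isSimplicialMap_glueRight (X : FinComplex U) (C : FinComplex T) (i : V → U) (j : V → T) :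
    IsSimplicialMap C (glue X C i j) (glueRight i j) := fun σ hσ =>
  Finset.mem_union_right _ (isSimplicialMap_image C _ σ hσ)

/-- The map `g` extends to `X` if and only if `X ∪_P C` retracts onto `Q`, for a mapping cylinder
`C` of `g : P → Q`. -/
theorem IsMappingCylinder.extendsPL_iff_glue {P : FinComplex V} {Q : FinComplex W} {g : V → W}
    {C : FinComplex T} {iP : V → T} {iQ : W → T} {r : T → W}
    (hg : IsSimplicialMap P Q g) (hC : IsMappingCylinder P Q g C iP iQ r) {X : FinComplex U}
    {i : V → U} (hi : IsSubcomplexEmbedding P X i) :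
    ExtendsPL P X Q i (realize g) ↔
      ExtendsPL Q (glue X C i iP) Q (fun w => glueRight i iP (iQ w)) id := by
  classical
  have hinl := (isSimplicialMap_inl_glue X C i iP).mapsTo_realize
  have hright := (isSimplicialMap_glueRight X C i iP).mapsTo_realize
  constructor
  · rintro ⟨G, hG, hGg⟩
    obtain ⟨hG, hGQ⟩ := isPLMap_iff.1 hG
    let K := X.image (Sum.inl : U → GlueVertex U iP)
    let L := C.image (glueRight i iP)
    have hbody : (glue X C i iP).body = K.body ∪ L.body := FinComplex.body_union _ _
    have hK : ∀ z ∈ K.body, z ∘ Sum.inl ∈ X.body := fun z hz =>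
      (comp_mem_body Sum.inl_injective hz).1
    have hL : ∀ z ∈ L.body, z ∘ glueRight i iP ∈ C.body := fun z hz =>
      (comp_mem_body (glueRight_injective hi.1 hC.embP.1) hz).1
    let F : (GlueVertex U iP → ℝ) → (W → ℝ) := fun z =>
      if z ∈ K.body then G (z ∘ Sum.inl) else realize r (z ∘ glueRight i iP)
    have hFK : ∀ z ∈ K.body, F z = G (z ∘ Sum.inl) := fun z hz => if_pos hz
    have hFL : ∀ z ∈ L.body, F z = realize r (z ∘ glueRight i iP) := by
      intro z hz
      by_cases hzK : z ∈ K.body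
      · obtain ⟨x, hx, h1, h2⟩ := exists_of_mem_body_inter hi.1 hC.embP.1 hC.full hzK hz
        rw [hFK z hzK, h1, h2, hGg x hx, realize_realize, hC.retr_comp_iP]
      · exact if_neg hzK
    refine ⟨F, isPLMap_iff.2 ⟨?_, ?_⟩, fun y hy => ?_⟩
    · rw [hbody]
      refine PLOn.union ?_ ?_ K.isClosed_body L.isClosed_body K.isSemilinear_body
        L.isSemilinear_body
      · exact (hG.comp (plOn_comp_right _ _) hK).congr hFK
      · exact ((plOn_realize r Set.univ).comp (plOn_comp_right _ _) (Set.mapsTo_univ _ _)).congr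
          hFL
    · rw [hbody]
      rintro z (hz | hz)
      · rw [hFK z hz]
        exact hGQ (hK z hz)
      · rw [hFL z hz]
        exact hC.retr.mapsTo_realize (hL z hz)
    · have hyC := hC.embQ.2.mapsTo_realize hy
      have hyL := (isSimplicialMap_image C (glueRight i iP)).mapsTo_realize hyC
      have hcomp : realize (glueRight i iP) (realize iQ y) ∘ glueRight i iP = realize iQ y :=
        funext fun t => realize_apply_of_injective (glueRight_injective hi.1 hC.embP.1) _ t
      have := hFL _ hyL
      rw [hcomp, realize_realize, realize_realize, hC.retr_comp_iQ, realize_id] at this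
      exact this
  · rintro ⟨F, hF, hFid⟩
    obtain ⟨hF, hFQ⟩ := isPLMap_iff.1 hF
    obtain ⟨h, hh, hhC, h01⟩ := exists_plOn_homotopy_of_contiguous hC.join
    obtain ⟨G, hG, hGH⟩ := exists_extension_of_homotopy hi
      (F := fun z => F (realize Sum.inl z)) (hF.comp (plOn_realize _ _) hinl)
      (fun z hz => hFQ (hinl hz)) (H := fun q => F (realize (glueRight i iP) (h q)))
      (hF.comp ((plOn_realize (glueRight i iP) C.body).comp hh hhC) fun q hq => hright (hhC hq))
      (fun q hq => hFQ (hright (hhC hq))) fun x hx => by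
        have : glueRight i iP ∘ iP = Sum.inl ∘ i :=
          funext fun v => glueRight_apply hC.embP.1 v
        simp only [(h01 x hx).1, realize_realize, this]
    refine ⟨G, hG, fun x hx => ?_⟩
    have := hFid _ (hg.mapsTo_realize hx)
    rw [realize_realize] at this
    rw [hGH x hx]
    simp only [(h01 x hx).2, realize_realize]
    exact this

end Gluing

/-! ### The algorithm -/

section Algorithm

/-- All the subsets of the set of entries of a list, again as lists. -/
def subsetLists (s : List ℕ) : List (List ℕ) :=
  s.foldr (fun a acc => acc ++ acc.map (a :: ·)) [[]]

/-- The code of the mapping cylinder of `g : P → Q`, computed from the codes of `P`, `Q` and `g`.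
The vertices of `Q` are renumbered to come after those of `P`. -/
def cylinderCode (c : ComplexCode × ComplexCode × List ℕ) : ComplexCode × List ℕ × List ℕ :=
  ((c.1.1 + c.2.1.1,
    (c.1.2.flatMap fun s => subsetLists (s ++ s.map fun v => c.1.1 + c.2.2.getD v 0)) ++
      c.2.1.2.map fun s => s.map fun w => c.1.1 + w),
    List.range c.1.1, (List.range c.2.1.1).map fun w => c.1.1 + w)

theorem toFinset_map_subsetLists (s : List ℕ) :
    ((subsetLists s).map List.toFinset).toFinset = s.toFinset.powerset := by
  induction s with
  | nil => rfl
  | cons a s ih =>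
    have hcons : subsetLists (a :: s) = subsetLists s ++ (subsetLists s).map (a :: ·) := rfl
    rw [hcons, List.toFinset_cons, Finset.powerset_insert, ← ih]
    ext τ
    simp

theorem exists_mem_subsetLists {s : List ℕ} {τ : Finset ℕ} :
    (∃ l ∈ subsetLists s, l.toFinset = τ) ↔ τ ⊆ s.toFinset := by
  rw [← Finset.mem_powerset, ← toFinset_map_subsetLists]
  simp

theorem primrec_subsetLists : Primrec subsetLists := by
  have hmap : Primrec fun r : List ℕ × ℕ × List (List ℕ) => r.2.2.map (r.2.1 :: ·) :=
    Primrec.list_map (Primrec.snd.comp Primrec.snd)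
      (Primrec.list_cons.comp (Primrec.fst.comp (Primrec.snd.comp Primrec.fst)) Primrec.snd)
  exact Primrec.list_foldr (h := fun _ q => q.2 ++ q.2.map (q.1 :: ·)) Primrec.id
    (Primrec.const [[]]) (Primrec.list_append.comp (Primrec.snd.comp Primrec.snd) hmap)

theorem primrec_cylinderCode : Primrec cylinderCode := by
  have hm : Primrec fun c : ComplexCode × ComplexCode × List ℕ => c.1.1 :=
    Primrec.fst.comp Primrec.fst
  have hp : Primrec fun c : ComplexCode × ComplexCode × List ℕ => c.1.2 :=
    Primrec.snd.comp Primrec.fst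
  have hn : Primrec fun c : ComplexCode × ComplexCode × List ℕ => c.2.1.1 :=
    Primrec.fst.comp (Primrec.fst.comp Primrec.snd)
  have hq : Primrec fun c : ComplexCode × ComplexCode × List ℕ => c.2.1.2 :=
    Primrec.snd.comp (Primrec.fst.comp Primrec.snd)
  have hl : Primrec fun c : ComplexCode × ComplexCode × List ℕ => c.2.2 :=
    Primrec.snd.comp Primrec.snd
  have hadd : Primrec₂ fun (c : ComplexCode × ComplexCode × List ℕ) (w : ℕ) => c.1.1 + w :=
    Primrec.nat_add.comp (hm.comp Primrec.fst) Primrec.snd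
  refine Primrec.pair (Primrec.pair (Primrec.nat_add.comp hm hn)
    (Primrec.list_append.comp (Primrec.list_flatMap hp ?_) (Primrec.list_map hq ?_)))
    (Primrec.pair (Primrec.list_range.comp hm)
      (Primrec.list_map (Primrec.list_range.comp hn) hadd))
  · refine primrec_subsetLists.comp (Primrec.list_append.comp Primrec.snd ?_)
    refine Primrec.list_map Primrec.snd ?_
    exact Primrec.nat_add.comp (hm.comp (Primrec.fst.comp Primrec.fst))
      ((Primrec.list_getD 0).comp (hl.comp (Primrec.fst.comp Primrec.fst)) Primrec.snd)
  · exact Primrec.list_map Primrec.snd (hadd.comp (Primrec.fst.comp Primrec.fst) Primrec.snd)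

theorem IsComplexCode.exists_mem_iff {n : ℕ} {c : ComplexCode} {K : FinComplex (Fin n)}
    (h : IsComplexCode c K) (τ : Finset ℕ) :
    (∃ s ∈ c.2, s.toFinset = τ) ↔ ∃ σ ∈ K.faces, σ.image Fin.val = τ := by
  have := congrArg (τ ∈ ·) h.2
  simpa using this

theorem isComplexCode_cylinderCode {m n : ℕ} {P : FinComplex (Fin m)} {Q : FinComplex (Fin n)}
    {g : Fin m → Fin n} {p q : ComplexCode} {l : List ℕ} (hp : IsComplexCode p P)
    (hq : IsComplexCode q Q) (hl : IsMapCode l g) :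
    IsComplexCode (cylinderCode (p, q, l)).1
      (mappingCylinder P Q g (Fin.castAdd n) (Fin.natAdd m)) := by
  have hp1 : p.1 = m := hp.1
  have hq1 : q.1 = n := hq.1
  have hgetD : ∀ v : Fin m, l.getD v 0 = g v := by
    intro v
    rw [hl, List.getD_eq_getElem _ _ (by simp)]
    simp
  have hjoin : ∀ {s : List ℕ} {ρ : Finset (Fin m)}, ρ.image Fin.val = s.toFinset →
      (s ++ s.map fun v => m + l.getD v 0).toFinset =
        (ρ.image (Fin.castAdd n) ∪ ρ.image (Fin.natAdd m ∘ g)).image Fin.val := by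
    intro s ρ h
    have hmap : (s.map fun v => m + l.getD v 0).toFinset =
        s.toFinset.image fun v => m + l.getD v 0 := by
      ext
      simp
    rw [List.toFinset_append, hmap, ← h, Finset.image_union, Finset.image_image,
      Finset.image_image, Finset.image_image]
    congr 1
    refine Finset.image_congr fun v _ => ?_
    simp only [Function.comp_apply, hgetD, Fin.val_natAdd]
  have hmapQ : ∀ (s : List ℕ) (σ : Finset (Fin n)), σ.image Fin.val = s.toFinset →
      (s.map fun w => m + w).toFinset = (σ.image (Fin.natAdd m)).image Fin.val := by
    intro s σ h
    have hmap : (s.map fun w => m + w).toFinset = s.toFinset.image fun w => m + w := by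
      ext
      simp
    rw [hmap, ← h, Finset.image_image, Finset.image_image]
    rfl
  refine ⟨by simp [cylinderCode, hp1, hq1], ?_⟩
  ext τ
  simp only [cylinderCode, hp1, List.map_append, List.mem_toFinset, List.mem_append, List.mem_map,
    List.mem_flatMap, Finset.mem_image, mem_faces_mappingCylinder]
  constructor
  · rintro (⟨t, ⟨s, hs, ht⟩, rfl⟩ | ⟨_, ⟨s, hs, rfl⟩, rfl⟩)
    · obtain ⟨ρ, hρ, hρs⟩ := (hp.exists_mem_iff _).1 ⟨s, hs, rfl⟩
      have hsub := exists_mem_subsetLists.1 ⟨t, ht, rfl⟩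
      rw [hjoin hρs] at hsub
      obtain ⟨τ', hτ', h⟩ := Finset.subset_image_iff.1 hsub
      exact ⟨τ', Or.inl ⟨ρ, hρ, by exact_mod_cast hτ'⟩, h⟩
    · obtain ⟨σ, hσ, hσs⟩ := (hq.exists_mem_iff _).1 ⟨s, hs, rfl⟩
      exact ⟨_, Or.inr ⟨σ, hσ, rfl⟩, (hmapQ s σ hσs).symm⟩
  · rintro ⟨τ', ⟨ρ, hρ, hτ'⟩ | ⟨σ, hσ, rfl⟩, rfl⟩
    · obtain ⟨s, hs, hsρ⟩ := (hp.exists_mem_iff _).2 ⟨ρ, hρ, rfl⟩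
      have hsub := Finset.image_subset_image (f := Fin.val) hτ'
      rw [← hjoin hsρ.symm] at hsub
      obtain ⟨t, ht, h⟩ := exists_mem_subsetLists.2 hsub
      exact Or.inl ⟨t, ⟨s, hs, ht⟩, h⟩
    · obtain ⟨s, hs, hsσ⟩ := (hq.exists_mem_iff _).2 ⟨σ, hσ, rfl⟩
      exact Or.inr ⟨_, ⟨s, hs, rfl⟩, hmapQ s σ hsσ.symm⟩

theorem isMapCode_castAdd (m n : ℕ) : IsMapCode (List.range m) (Fin.castAdd n : Fin m → _) := by
  simp [IsMapCode, List.ofFn_eq_map]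

theorem isMapCode_natAdd (m n : ℕ) :
    IsMapCode ((List.range n).map fun w => m + w) (Fin.natAdd m : Fin n → _) := by
  refine List.ext_getElem (by simp) fun k h₁ h₂ => ?_
  simp

end Algorithm

/-- There is an algorithm `cyl` that constructs, from the data of a simplicial map `g : P → Q`, the
data of a complex `C` (a mapping cylinder of `g`) and of disjoint copies of `P` and `Q` in it, with
the properties (a) and (b) below. -/
theorem proposition1p6 :
    ∃ cyl : ComplexCode × ComplexCode × List ℕ → ComplexCode × List ℕ × List ℕ,
      Computable cyl ∧
      ∀ (m n : ℕ) (P : FinComplex (Fin m)) (Q : FinComplex (Fin n)) (g : Fin m → Fin n),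
        IsSimplicialMap P Q g →
        ∃ (k : ℕ) (C : FinComplex (Fin k)) (iP : Fin m → Fin k) (iQ : Fin n → Fin k),
          -- `(C; P, Q)` is what the algorithm constructs
          (∀ (p q : ComplexCode) (l : List ℕ),
            IsComplexCode p P → IsComplexCode q Q → IsMapCode l g →
              IsComplexCode (cyl (p, q, l)).1 C ∧
              IsMapCode (cyl (p, q, l)).2.1 iP ∧ IsMapCode (cyl (p, q, l)).2.2 iQ) ∧
          -- `P` and `Q` are disjoint subcomplexes of `C`, and `C` has no further faces on the
          -- vertices of `P` (so that `|X|` and `|C|` meet in `|P|` only in `X ∪_P C`)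
          IsSubcomplexEmbedding P C iP ∧ IsSubcomplexEmbedding Q C iQ ∧
          (∀ v w, iP v ≠ iQ w) ∧
          (∀ σ : Finset (Fin m), σ.image iP ∈ C.faces → σ ∈ P.faces) ∧
          -- (a)
          (∀ (W : Type) [Fintype W] [DecidableEq W] (Y : FinComplex W) (β : Fin m → W),
            IsSimplicialMap P Y β →
              (ExtendsPL P C Y iP (realize β) ↔
                ∃ κ : (Fin n → ℝ) → (W → ℝ), IsPLMap Q Y κ ∧
                  PLHomotopic P Y (κ ∘ realize g) (realize β))) ∧
          -- (b)
          (∀ (U : Type) [Fintype U] [DecidableEq U] (X : FinComplex U) (i : Fin m → U),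
            IsSubcomplexEmbedding P X i →
              (ExtendsPL P X Q i (realize g) ↔
                ExtendsPL Q (glue X C i iP) Q (fun w => glueRight i iP (iQ w)) id)) := by
  refine ⟨cylinderCode, primrec_cylinderCode.to_comp, fun m n P Q g hg => ?_⟩
  have hdisj : ∀ (v : Fin m) (w : Fin n), Fin.castAdd n v ≠ Fin.natAdd m w := by
    intro v w h
    have := congrArg Fin.val h
    simp only [Fin.val_castAdd, Fin.val_natAdd] at this
    omega
  have hC : IsMappingCylinder P Q g (mappingCylinder P Q g (Fin.castAdd n) (Fin.natAdd m))
      (Fin.castAdd n) (Fin.natAdd m) (Fin.append g id) :=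
    isMappingCylinder_mappingCylinder hg (Fin.castAdd_injective m n) hdisj
      (funext fun v => Fin.append_left g id v) (funext fun w => Fin.append_right g id w)
  refine ⟨m + n, mappingCylinder P Q g (Fin.castAdd n) (Fin.natAdd m), Fin.castAdd n,
    Fin.natAdd m, fun p q l hp hq hl => ⟨isComplexCode_cylinderCode hp hq hl, ?_, ?_⟩, hC.embP,
    hC.embQ, hdisj, hC.full, fun W _ _ Y β _ => hC.extendsPL_iff,
    fun U _ _ X i hi => hC.extendsPL_iff_glue hg hi⟩
  · have hp1 : p.1 = m := hp.1
    simpa [cylinderCode, hp1] using isMapCode_castAdd m n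
  · have hp1 : p.1 = m := hp.1
    have hq1 : q.1 = n := hq.1
    simpa [cylinderCode, hp1, hq1] using isMapCode_natAdd m n
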